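/- Let $(M,h,\nabla)$ and $(M',h',\nabla')$ be connected dually flat manifolds of dimensions $n$ and $d$: $M$ is a smooth manifold with a Riemannian metric $h$ and a linear connection $\nabla$ such that both $\nabla$ and its dual connection $\nabla^{*}$, defined by $X\,h(Y,Z)=h(\nabla_XY,Z)+h(Y,\nabla^{*}_XZ)$ for all vector fields $X,Y,Z$, are flat (have zero torsion and zero curvature); similarly for $M'$. Let $\pi:TM\to M$ be the projection and let $K:TTM\to TM$ be the connector of $\nabla$, that is, the map that is linear on each $T_u(TM)$, with values in $T_{\pi(u)}M$, and satisfies $K(Y_*X)=\nabla_XY$ for all vector fields $X,Y$. For $u\in T_pM$ identify $T_u(TM)$ with $T_pM\oplus T_pM$ by $A\mapsto(\pi_*A,KA)$, and let $$g_u\big((v,w),(\bar v,\bar w)\big)=h_p(v,\bar v)+h_p(w,\bar w),\qquad J_u(v,w)=(-w,v).$$ Endow $TM$ with this almost Hermitian structure $(g,J)$ (Dombrowski's construction), which is Kähler, and define $(g',J')$ on $TM'$ in the same way from $(h',\nabla')$. A coordinate system $(x_1,\dots,x_n)$ on an open subset of $M$ is $\nabla$-affine if $\nabla_{\partial/\partial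 x_i}\partial/\partial x_j=0$ for all $i,j$. A smooth map $f:M\to M'$ is affine if for every $p\in M$ there are a $\nabla$-affine coordinate system $x:U\to\mathbb{R}^n$ and a $\nabla'$-affine coordinate system $x':U'\to\mathbb{R}^d$ such that $p\in U$, $f(U)\subseteq U'$ and $x'\circ f\circ x^{-1}:x(U)\to\mathbb{R}^d$ is the restriction of an affine map $\mathbb{R}^n\to\mathbb{R}^d$. The map $f$ is isometric if $f^{*}h'=h$. The derivative $f_*:TM\to TM'$ is isometric if $(f_*)^{*}g'=g$, and holomorphic if $(f_*)_*\circ J=J'\circ(f_*)_*$; it is a Kähler immersion if it is a holomorphic isometric immersion. Let $f:M\to M'$ be a smooth map. 1. The derivative $f_*:TM\to TM'$ is holomorphic if and only if $f$ is affine. 2. Suppose that $f$ is affine. Then $f_*$ is isometric if and only if $f$ is isometric. Consequently, $f_*$ is a Kähler immersion if and only if $f$ is an isometric affine immersion. -/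

import Mathlib

open Bundle Set
open scoped Manifold ContDiff Topology

noncomputable section

namespace DuallyFlat

/-- Smooth vector fields on a smooth manifold. -/
def IsSmoothField {n : ℕ} {M : Type*} [TopologicalSpace M]
    [ChartedSpace (EuclideanSpace ℝ (Fin n)) M] [IsManifold (𝓡 n) ∞ M]
    (X : ∀ p : M, TangentSpace (𝓡 n) p) : Prop :=
  ContMDiff (𝓡 n) (𝓡 n).tangent ∞ (fun p ↦ (⟨p, X p⟩ : TangentBundle (𝓡 n) M))

/-- Linear connections on the tangent bundle. In Mathlib's convention `D Y p (X p)` is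
`(∇_X Y)(p)`. -/
abbrev Connection (n : ℕ) (M : Type*) [TopologicalSpace M]
    [ChartedSpace (EuclideanSpace ℝ (Fin n)) M] [IsManifold (𝓡 n) ∞ M] :=
  CovariantDerivative (𝓡 n) (EuclideanSpace ℝ (Fin n)) (TangentSpace (𝓡 n) : M → Type _)

/-- Smooth Riemannian metrics. -/
abbrev Metric (n : ℕ) (M : Type*) [TopologicalSpace M]
    [ChartedSpace (EuclideanSpace ℝ (Fin n)) M] [IsManifold (𝓡 n) ∞ M] :=
  ContMDiffRiemannianMetric (𝓡 n) ∞ (EuclideanSpace ℝ (Fin n))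
    (TangentSpace (𝓡 n) : M → Type _)

section Manifold

variable {n : ℕ} {M : Type*} [TopologicalSpace M]
  [ChartedSpace (EuclideanSpace ℝ (Fin n)) M] [IsManifold (𝓡 n) ∞ M]

/-- The vector field `∇_X Y`. -/
def nabla (D : Connection n M) (X Y : ∀ p : M, TangentSpace (𝓡 n) p) (p : M) :
    TangentSpace (𝓡 n) p :=
  D Y p (X p)

/-- The curvature `R(X,Y)Z = ∇_X ∇_Y Z - ∇_Y ∇_X Z - ∇_[X,Y] Z`. -/
def curvature (D : Connection n M) (X Y Z : ∀ p : M, TangentSpace (𝓡 n) p) (p : M) :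
    TangentSpace (𝓡 n) p :=
  nabla D X (nabla D Y Z) p - nabla D Y (nabla D X Z) p
    - nabla D (VectorField.mlieBracket (𝓡 n) X Y) Z p

/-- A connection is flat if its torsion and its curvature vanish identically. -/
structure IsFlat (D : Connection n M) : Prop where
  torsion_eq_zero : ∀ p : M, D.torsion p = 0
  curvature_eq_zero : ∀ X Y Z : ∀ p : M, TangentSpace (𝓡 n) p,
    IsSmoothField X → IsSmoothField Y → IsSmoothField Z → ∀ p, curvature D X Y Z p = 0

/-- `D'` is dual to `D` with respect to `h`:
`X h(Y,Z) = h(∇_X Y, Z) + h(Y, ∇*_X Z)` for all smooth vector fields. -/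
def IsDual (h : Metric n M) (D D' : Connection n M) : Prop :=
  ∀ X Y Z : ∀ p : M, TangentSpace (𝓡 n) p,
    IsSmoothField X → IsSmoothField Y → IsSmoothField Z → ∀ p,
      mvfderiv (𝓡 n) (fun q ↦ h.inner q (Y q) (Z q)) p (X p)
        = h.inner p (nabla D X Y p) (Z p) + h.inner p (Y p) (nabla D' X Z p)

/-- The field `∑ vⱼ ∂/∂xⱼ` of a chart `x`, for a constant `v ∈ ℝⁿ`: at each point of the source
of `x` it is the preimage of `v` under the derivative of `x`. -/
def coordField (x : OpenPartialHomeomorph M (EuclideanSpace ℝ (Fin n)))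
    (v : EuclideanSpace ℝ (Fin n)) (p : M) : TangentSpace (𝓡 n) p :=
  VectorField.mpullback (𝓡 n) (𝓡 n) x (fun _ ↦ v) p

/-- `x` is a smooth chart of `M` with `∇_{∂/∂xᵢ} ∂/∂xⱼ = 0` on its domain. -/
structure IsAffineChart (D : Connection n M)
    (x : OpenPartialHomeomorph M (EuclideanSpace ℝ (Fin n))) : Prop where
  mem_maximalAtlas : x ∈ IsManifold.maximalAtlas (𝓡 n) ∞ M
  nabla_eq_zero : ∀ i j : Fin n, ∀ p ∈ x.source,
    nabla D (coordField x (EuclideanSpace.single i 1))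
      (coordField x (EuclideanSpace.single j 1)) p = 0

/-- The derivative `π_*` of the projection `π : TM → M` at `u`. -/
def projDeriv (u : TangentBundle (𝓡 n) M) :
    TangentSpace (𝓡 n).tangent u →L[ℝ] TangentSpace (𝓡 n) u.proj :=
  mfderiv (𝓡 n).tangent (𝓡 n) (TotalSpace.proj : TangentBundle (𝓡 n) M → M) u

/-- The vertical coordinates `(r₁, …, rₙ)` of a vector in `T_u(TM)`. Here `T_u(TM)` is
`ℝⁿ × ℝⁿ` and `T_pM`, `p = π(u)`, is `ℝⁿ`, both by means of the preferred chart at `p`: the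
pair `(a, b)` is `∑ aᵢ ∂/∂qᵢ + bᵢ ∂/∂rᵢ`, and its vertical coordinates `b` stand for
`∑ bᵢ ∂/∂xᵢ`. -/
def vertCoord (u : TangentBundle (𝓡 n) M) :
    TangentSpace (𝓡 n).tangent u →L[ℝ] TangentSpace (𝓡 n) u.proj :=
  ContinuousLinearMap.snd ℝ (EuclideanSpace ℝ (Fin n)) (EuclideanSpace ℝ (Fin n))

/-- The connector `K_u : T_u(TM) → T_pM` of `∇`, in the preferred chart `x` at `p = π(u)`:
`K_u(∑ aᵢ ∂/∂qᵢ + bᵢ ∂/∂rᵢ) = ∑ bᵢ ∂/∂xᵢ + ∑ aᵢ uⱼ ∇_{∂/∂xᵢ} ∂/∂xⱼ`. -/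
def connector (D : Connection n M) (u : TangentBundle (𝓡 n) M) :
    TangentSpace (𝓡 n).tangent u →L[ℝ] TangentSpace (𝓡 n) u.proj :=
  vertCoord u + (D (coordField (chartAt (EuclideanSpace ℝ (Fin n)) u.proj) u.snd) u.proj).comp
    (projDeriv u)

theorem projDeriv_apply (u : TangentBundle (𝓡 n) M) (A : TangentSpace (𝓡 n).tangent u) :
    projDeriv u A
      = (ContinuousLinearMap.fst ℝ (EuclideanSpace ℝ (Fin n)) (EuclideanSpace ℝ (Fin n)) A) := by
  have key : HasMFDerivAt (𝓡 n).tangent (𝓡 n) (TotalSpace.proj : TangentBundle (𝓡 n) M → M) u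
      (ContinuousLinearMap.fst ℝ (EuclideanSpace ℝ (Fin n)) (EuclideanSpace ℝ (Fin n))) := by
    have h1 : ∀ y ∈ (extChartAt (𝓡 n).tangent u).target,
        writtenInExtChartAt (𝓡 n).tangent (𝓡 n) u
          (TotalSpace.proj : TangentBundle (𝓡 n) M → M) y = y.1 := by
      intro y hy
      simp only [mfld_simps] at hy
      simp only [mfld_simps]
      exact (chartAt _ u.proj).right_inv ((TangentBundle.mem_chart_target_iff _ u).1 hy)
    refine ⟨(FiberBundle.continuous_proj _ _).continuousAt, ?_⟩
    refine HasFDerivWithinAt.congr_of_eventuallyEq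
      (ContinuousLinearMap.hasFDerivWithinAt _) ?_ ?_
    · filter_upwards [extChartAt_target_mem_nhdsWithin (I := (𝓡 n).tangent) u] with y hy
      exact h1 y hy
    · exact h1 _ (mem_extChartAt_target u)
  unfold projDeriv
  rw [key.mfderiv]
  rfl

/-- `A ↦ (π_* A, K A)`, as a map `T_u(TM) → T_pM ⊕ T_pM`. -/
def split (D : Connection n M) (u : TangentBundle (𝓡 n) M) :
    TangentSpace (𝓡 n).tangent u →ₗ[ℝ] TangentSpace (𝓡 n) u.proj × TangentSpace (𝓡 n) u.proj :=
  ((projDeriv u).prod (connector D u)).toLinearMap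

theorem split_bijective (D : Connection n M) (u : TangentBundle (𝓡 n) M) :
    Function.Bijective (split D u) := by
  set L := D (coordField (chartAt (EuclideanSpace ℝ (Fin n)) u.proj) u.snd) u.proj
  have hs : ∀ A : TangentSpace (𝓡 n).tangent u,
      split D u A = (projDeriv u A, vertCoord u A + L (projDeriv u A)) := fun A ↦ rfl
  have hinj : ∀ A B : TangentSpace (𝓡 n).tangent u, projDeriv u A = projDeriv u B →
      vertCoord u A = vertCoord u B → A = B := by
    intro A B h1 h2
    rw [projDeriv_apply, projDeriv_apply] at h1
    exact Prod.ext h1 h2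
  constructor
  · intro A B h
    rw [hs, hs, Prod.mk.injEq] at h
    refine hinj A B h.1 ?_
    have h2 := h.2
    rw [h.1] at h2
    exact add_right_cancel h2
  · rintro ⟨v, w⟩
    let A : TangentSpace (𝓡 n).tangent u :=
      ((v, w - L v) : EuclideanSpace ℝ (Fin n) × EuclideanSpace ℝ (Fin n))
    have h1 : projDeriv u A = v := projDeriv_apply u A
    have h2 : vertCoord u A = w - L v := rfl
    refine ⟨A, ?_⟩
    rw [hs, h1, h2, sub_add_cancel]

/-- The identification `T_u(TM) ≅ T_pM ⊕ T_pM` given by a connection. -/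
def splitEquiv (D : Connection n M) (u : TangentBundle (𝓡 n) M) :
    TangentSpace (𝓡 n).tangent u ≃ₗ[ℝ] TangentSpace (𝓡 n) u.proj × TangentSpace (𝓡 n) u.proj :=
  LinearEquiv.ofBijective (split D u) (split_bijective D u)

/-- The almost complex structure `J_u(v, w) = (-w, v)` of Dombrowski's construction. -/
def complexStructure (D : Connection n M) (u : TangentBundle (𝓡 n) M)
    (A : TangentSpace (𝓡 n).tangent u) : TangentSpace (𝓡 n).tangent u :=
  (splitEquiv D u).symm (-(splitEquiv D u A).2, (splitEquiv D u A).1)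

/-- The metric `g_u((v, w), (v', w')) = h_p(v, v') + h_p(w, w')` of Dombrowski's construction. -/
def tangentMetric (h : Metric n M) (D : Connection n M) (u : TangentBundle (𝓡 n) M)
    (A B : TangentSpace (𝓡 n).tangent u) : ℝ :=
  h.inner u.proj (splitEquiv D u A).1 (splitEquiv D u B).1
    + h.inner u.proj (splitEquiv D u A).2 (splitEquiv D u B).2

end Manifold

/-- A dually flat structure `(h, ∇, ∇*)` on a smooth manifold. -/
structure DuallyFlatStructure (n : ℕ) (M : Type*) [TopologicalSpace M]
    [ChartedSpace (EuclideanSpace ℝ (Fin n)) M] [IsManifold (𝓡 n) ∞ M] where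
  /-- the Riemannian metric `h` -/
  metric : Metric n M
  /-- the connection `∇` -/
  conn : Connection n M
  /-- the dual connection `∇*` -/
  dualConn : Connection n M
  smooth_conn : conn.ContMDiffCovariantDerivative ∞
  smooth_dualConn : dualConn.ContMDiffCovariantDerivative ∞
  isDual : IsDual metric conn dualConn
  flat_conn : IsFlat conn
  flat_dualConn : IsFlat dualConn

/-- `f` is affine: near every point it is, in suitable affine charts, the restriction of an
affine map `ℝⁿ → ℝᵈ`. -/
def IsAffine {n d : ℕ} {M M' : Type*}
    [TopologicalSpace M] [ChartedSpace (EuclideanSpace ℝ (Fin n)) M] [IsManifold (𝓡 n) ∞ M]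
    [TopologicalSpace M'] [ChartedSpace (EuclideanSpace ℝ (Fin d)) M'] [IsManifold (𝓡 d) ∞ M']
    (D : Connection n M) (D' : Connection d M') (f : M → M') : Prop :=
  ∀ p : M, ∃ (x : OpenPartialHomeomorph M (EuclideanSpace ℝ (Fin n)))
    (x' : OpenPartialHomeomorph M' (EuclideanSpace ℝ (Fin d)))
    (a : EuclideanSpace ℝ (Fin n) →ᵃ[ℝ] EuclideanSpace ℝ (Fin d)),
    IsAffineChart D x ∧ IsAffineChart D' x' ∧ p ∈ x.source ∧ MapsTo f x.source x'.source ∧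
      ∀ y ∈ x.target, x' (f (x.symm y)) = a y

section Maps

variable {E H E' H' : Type*} [NormedAddCommGroup E] [NormedSpace ℝ E] [TopologicalSpace H]
  [NormedAddCommGroup E'] [NormedSpace ℝ E'] [TopologicalSpace H']
  (I : ModelWithCorners ℝ E H) (I' : ModelWithCorners ℝ E' H')
  {N N' : Type*} [TopologicalSpace N] [ChartedSpace H N] [TopologicalSpace N'] [ChartedSpace H' N']

/-- A smooth map whose derivative commutes with the (almost) complex structures. -/
def IsHolomorphic (J : ∀ q : N, TangentSpace I q → TangentSpace I q)
    (J' : ∀ q : N', TangentSpace I' q → TangentSpace I' q) (F : N → N') : Prop :=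
  ContMDiff I I' ∞ F ∧
    ∀ (q : N) (A : TangentSpace I q), mfderiv I I' F q (J q A) = J' (F q) (mfderiv I I' F q A)

/-- A smooth map with `F^* g' = g`. -/
def IsIsometric (g : ∀ q : N, TangentSpace I q → TangentSpace I q → ℝ)
    (g' : ∀ q : N', TangentSpace I' q → TangentSpace I' q → ℝ) (F : N → N') : Prop :=
  ContMDiff I I' ∞ F ∧
    ∀ (q : N) (A B : TangentSpace I q),
      g' (F q) (mfderiv I I' F q A) (mfderiv I I' F q B) = g q A B

/-- A smooth map with injective derivative at every point. -/
def IsSmoothImmersion (F : N → N') : Prop :=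
  ContMDiff I I' ∞ F ∧ ∀ q : N, Function.Injective (mfderiv I I' F q)

/-- A holomorphic isometric immersion. -/
def IsKahlerImmersion (g : ∀ q : N, TangentSpace I q → TangentSpace I q → ℝ)
    (J : ∀ q : N, TangentSpace I q → TangentSpace I q)
    (g' : ∀ q : N', TangentSpace I' q → TangentSpace I' q → ℝ)
    (J' : ∀ q : N', TangentSpace I' q → TangentSpace I' q) (F : N → N') : Prop :=
  IsSmoothImmersion I I' F ∧ IsHolomorphic I I' J J' F ∧ IsIsometric I I' g g' F

end Maps

end DuallyFlat

end

/-! Let `∇df` be the Hessian of `f` with respect to the two connections. In the splittings `(π_*,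
K)` of `TTM` and `TTM'`, the derivative of `f_*` at `u` is `(v, w) ↦ (df v, df w + ∇df(v, u))`
(`splitEquiv_mfderiv_tangentMap`). Comparing its composites with `J` and `J'` on `(v, w)` leaves the
two conditions `∇df(v, u) = 0` and `∇df(w, u) = 0`, so `f_*` is holomorphic exactly when the Hessian
vanishes (`isHolomorphic_tangentMap_iff_hessian`).

In affine charts the Christoffel symbols vanish and the Hessian is the ordinary second derivative
(`chartDeriv_hessian`). It therefore vanishes when `f` is affine. Conversely, a map with zero second
derivative on a ball is affine there, which makes `f` affine as soon as affine charts exist near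
every point (`exists_isAffineChart`).

That existence is where flatness enters. Affine coordinates `X` solve the overdetermined system
`D²X(a, u) = DX(Γ(a, u))`, a linear total differential equation for `(X, DX)`. Its integrability
conditions are the symmetry of `Γ` (no torsion) and the curvature identity, and a Frobenius theorem,
proved here by integrating along rays, supplies the solution.

For affine `f` the derivative of `f_*` becomes `df ⊕ df`, and `g` and `g'` are orthogonal sums of
two copies of `h` and `h'`, so isometry and injectivity pass between `f_*` and `f`. -/

noncomputable section

set_option linter.unusedSectionVars false

namespace DuallyFlat

/-! ### Frobenius theorem for linear systems, and affine coordinates in a vector space. -/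

section Frobenius

variable {E W : Type*} [NormedAddCommGroup E] [NormedSpace ℝ E]
  [NormedAddCommGroup W] [NormedSpace ℝ W]

/-- Shortcut for instance search. -/
local instance normedGroupEnd : NormedAddCommGroup (W →L[ℝ] W) :=
  ContinuousLinearMap.toNormedAddCommGroup

/-- Shortcut for instance search. -/
local instance normedSpaceEnd : NormedSpace ℝ (W →L[ℝ] W) :=
  ContinuousLinearMap.toNormedSpace

/-- Shortcut for instance search. -/
local instance normedGroupHomEnd : NormedAddCommGroup (E →L[ℝ] W →L[ℝ] W) :=
  ContinuousLinearMap.toNormedAddCommGroup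

/-- Shortcut for instance search. -/
local instance normedSpaceHomEnd : NormedSpace ℝ (E →L[ℝ] W →L[ℝ] W) :=
  ContinuousLinearMap.toNormedSpace

/-- Shortcut for instance search. -/
local instance normedGroupHomHomEnd : NormedAddCommGroup (E →L[ℝ] E →L[ℝ] W →L[ℝ] W) :=
  ContinuousLinearMap.toNormedAddCommGroup

/-- The equation `φ' = A(tx)(x) φ`, to which a linear total differential equation `dZ = A Z`
reduces along the ray through `x`, has a solution on `[0, 1]` when `x` is small. -/
theorem exists_ray_solution [CompleteSpace W] {A : E → E →L[ℝ] W →L[ℝ] W} {r K : ℝ} {z₀ : W}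
    (hcont : ContinuousOn A (Metric.ball 0 r)) (hK0 : 0 ≤ K)
    (hK : ∀ y ∈ Metric.ball (0 : E) r, ‖A y‖ ≤ K) (hr : K * r * (‖z₀‖ + 1) ≤ 1)
    {x : E} (hx : x ∈ Metric.ball (0 : E) r) :
    ∃ φ : ℝ → W, φ 0 = z₀ ∧
      ∀ t ∈ Icc (0 : ℝ) 1, HasDerivWithinAt φ (A (t • x) x (φ t)) (Icc 0 1) t := by
  have hxr : ‖x‖ < r := by simpa using hx
  have hmem : ∀ t ∈ Icc (0 : ℝ) 1, t • x ∈ Metric.ball (0 : E) r := by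
    intro t ht
    rw [mem_ball_zero_iff, norm_smul, Real.norm_of_nonneg ht.1]
    nlinarith [norm_nonneg x, ht.2, ht.1]
  have hop : ∀ t ∈ Icc (0 : ℝ) 1, ‖A (t • x) x‖ ≤ K * r := fun t ht ↦
    ((A (t • x)).le_opNorm x).trans
      (mul_le_mul (hK _ (hmem t ht)) hxr.le (norm_nonneg _) hK0)
  have hKr : 0 ≤ K * r := mul_nonneg hK0 ((norm_nonneg x).trans hxr.le)
  -- The hypothesis `hr` bounds the speed by `1` on the unit ball about `z₀`, so a solution cannot
  -- leave that ball before time `1`.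
  have hPL : IsPicardLindelof (fun t φ ↦ A (t • x) x φ) (⟨0, by simp⟩ : Icc (0 : ℝ) 1) z₀ 1 0 1
      ⟨K * r, hKr⟩ := by
    refine ⟨fun t ht ↦ ?_, fun z _ ↦ ?_, fun t ht z hz ↦ ?_, by simp⟩
    · refine LipschitzWith.lipschitzOnWith (LipschitzWith.weaken (A (t • x) x).lipschitz ?_)
      exact hop t ht
    · have h1 : ContinuousOn (fun t : ℝ ↦ A (t • x)) (Icc 0 1) :=
        hcont.comp (by fun_prop) hmem
      exact (h1.clm_apply continuousOn_const).clm_apply continuousOn_const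
    · have hz' : ‖z‖ ≤ ‖z₀‖ + 1 := by
        have := norm_le_norm_add_norm_sub z₀ z
        rw [mem_closedBall_iff_norm] at hz
        have h2 : ‖z₀ - z‖ = ‖z - z₀‖ := norm_sub_rev _ _
        have h3 : ‖z‖ ≤ ‖z₀‖ + ‖z - z₀‖ := by
          simpa using norm_add_le z₀ (z - z₀)
        have : ((1 : NNReal) : ℝ) = 1 := rfl
        linarith
      calc ‖A (t • x) x z‖ ≤ ‖A (t • x) x‖ * ‖z‖ := (A (t • x) x).le_opNorm z
        _ ≤ K * r * (‖z₀‖ + 1) := mul_le_mul (hop t ht) hz' (norm_nonneg _) hKr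
        _ ≤ 1 := hr
  exact hPL.exists_eq_forall_mem_Icc_hasDerivWithinAt₀

/-- The quadratic error made by the first order Taylor expansion of a function with Lipschitz
derivative. -/
theorem norm_sub_sub_le_of_lipschitz_deriv {G : Type*} [NormedAddCommGroup G] [NormedSpace ℝ G]
    {A : E → G} {A' : E → E →L[ℝ] G} {s : Set E} (hs : Convex ℝ s) {K : ℝ} (hK0 : 0 ≤ K)
    (hA : ∀ y ∈ s, HasFDerivAt A (A' y) y)
    (hL : ∀ y ∈ s, ∀ z ∈ s, ‖A' y - A' z‖ ≤ K * ‖y - z‖) {y z : E} (hy : y ∈ s) (hz : z ∈ s) :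
    ‖A z - A y - A' y (z - y)‖ ≤ K * ‖z - y‖ ^ 2 := by
  have hseg : segment ℝ y z ⊆ s := hs.segment_subset hy hz
  have := (convex_segment y z).norm_image_sub_le_of_norm_hasFDerivWithin_le' (f := A) (f' := A')
    (φ := A' y) (C := K * ‖z - y‖)
    (fun w hw ↦ (hA w (hseg hw)).hasFDerivWithinAt)
    (fun w hw ↦ (hL w (hseg hw) y hy).trans (by
      gcongr
      exact norm_sub_le_of_mem_segment hw)) (left_mem_segment ℝ y z) (right_mem_segment ℝ y z)
  calc _ ≤ K * ‖z - y‖ * ‖z - y‖ := this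
    _ = _ := by ring

/-- Linearity in the error term turns a velocity defect quadratic in `h` into a distance quadratic
in `h`. -/
theorem gronwallBound_zero_left (K ε t : ℝ) :
    gronwallBound 0 K ε t = gronwallBound 0 K 1 t * ε := by
  unfold gronwallBound
  split_ifs <;> ring

/-- Here `A₀`, `A₁`, `D` stand for `A (t • x)`, `A (t • (x + h))` and the derivative of `A` at `t •
x`. The curve `φ + t • A₀ h φ` is the first order guess for the solution along the ray through `x +
h`, and the estimated quantity is its defect in that equation. The integrability condition `hI`
cancels every term linear in `h`. -/
theorem ray_error_le {A₀ A₁ : E →L[ℝ] W →L[ℝ] W} {D : E →L[ℝ] E →L[ℝ] W →L[ℝ] W}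
    {K r t m : ℝ} (hK0 : 0 ≤ K) (hr : r ≤ 1) (h0 : ‖A₀‖ ≤ K) (h1 : ‖A₁‖ ≤ K) (hD : ‖D‖ ≤ K)
    (ht : t ∈ Icc (0 : ℝ) 1) {x h : E} (hx : ‖x‖ ≤ r) (hxh : ‖x + h‖ ≤ r)
    (hR : ‖A₁ - A₀ - D (t • h)‖ ≤ K * ‖t • h‖ ^ 2)
    (hd : ‖A₁ - A₀‖ ≤ K * ‖t • h‖)
    (hI : D x h + (A₀ h).comp (A₀ x) = D h x + (A₀ x).comp (A₀ h)) {φ : W} (hφ : ‖φ‖ ≤ m) :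
    ‖(A₀ x φ + (A₀ h φ + t • (D x h φ + A₀ h (A₀ x φ)))) - A₁ (x + h) (φ + t • A₀ h φ)‖
      ≤ (2 * K + 2 * K ^ 2) * m * ‖h‖ ^ 2 := by
  have hIφ : D x h φ + A₀ h (A₀ x φ) = D h x φ + A₀ x (A₀ h φ) := by
    simpa using congrArg (fun L : W →L[ℝ] W ↦ L φ) hI
  have key : (A₀ x φ + (A₀ h φ + t • (D x h φ + A₀ h (A₀ x φ)))) - A₁ (x + h) (φ + t • A₀ h φ)
      = -(t • D h h φ + (A₁ - A₀ - D (t • h)) (x + h) φ + t • (A₁ - A₀) x (A₀ h φ)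
        + t • A₁ h (A₀ h φ)) := by
    rw [hIφ]
    simp only [map_add, map_smul, add_apply, sub_apply, smul_apply, smul_add, smul_sub]
    abel
  have hm : 0 ≤ m := (norm_nonneg _).trans hφ
  have hth : ‖t • h‖ ≤ ‖h‖ := by
    rw [norm_smul, Real.norm_of_nonneg ht.1]
    exact mul_le_of_le_one_left (norm_nonneg _) ht.2
  have htn : ∀ w : W, ‖t • w‖ ≤ ‖w‖ := fun w ↦ by
    rw [norm_smul, Real.norm_of_nonneg ht.1]
    exact mul_le_of_le_one_left (norm_nonneg _) ht.2
  have hA₀φ : ‖A₀ h φ‖ ≤ K * ‖h‖ * m := (A₀.le_opNorm₂ h φ).trans (by gcongr)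
  have e1 : ‖t • D h h φ‖ ≤ K * ‖h‖ * ‖h‖ * m :=
    (htn _).trans (((D h).le_opNorm₂ h φ).trans (by
      gcongr
      exact (D.le_opNorm h).trans (by gcongr)))
  have e2 : ‖(A₁ - A₀ - D (t • h)) (x + h) φ‖ ≤ K * ‖h‖ ^ 2 * 1 * m :=
    ((A₁ - A₀ - D (t • h)).le_opNorm₂ _ _).trans (by
      gcongr
      · exact hR.trans (by gcongr)
      · exact hxh.trans hr)
  have e3 : ‖t • (A₁ - A₀) x (A₀ h φ)‖ ≤ (K * ‖h‖) * 1 * (K * ‖h‖ * m) :=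
    (htn _).trans (((A₁ - A₀).le_opNorm₂ _ _).trans (by
      gcongr
      · exact hd.trans (by gcongr)
      · exact hx.trans hr))
  have e4 : ‖t • A₁ h (A₀ h φ)‖ ≤ K * ‖h‖ * (K * ‖h‖ * m) :=
    (htn _).trans ((A₁.le_opNorm₂ _ _).trans (by gcongr))
  rw [key, norm_neg]
  refine (norm_add_le _ _).trans ?_
  refine (add_le_add (norm_add₃_le.trans (add_le_add (add_le_add e1 e2) e3)) e4).trans (le_of_eq ?_)
  ring

/-- **Frobenius theorem** for a linear total differential equation `dZ = A Z`, in quantitative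
form at the origin. -/
theorem exists_hasFDerivAt_of_bounds [CompleteSpace W] {A : E → E →L[ℝ] W →L[ℝ] W}
    {A' : E → E →L[ℝ] E →L[ℝ] W →L[ℝ] W} {r K : ℝ} {z₀ : W} (hK0 : 0 ≤ K) (hr0 : 0 < r)
    (hr1 : r ≤ 1) (hA : ∀ y ∈ Metric.ball (0 : E) r, HasFDerivAt A (A' y) y)
    (hK : ∀ y ∈ Metric.ball (0 : E) r, ‖A y‖ ≤ K) (hK' : ∀ y ∈ Metric.ball (0 : E) r, ‖A' y‖ ≤ K)
    (hL : ∀ y ∈ Metric.ball (0 : E) r, ∀ z ∈ Metric.ball (0 : E) r,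
      ‖A' y - A' z‖ ≤ K * ‖y - z‖)
    (hI : ∀ y ∈ Metric.ball (0 : E) r, ∀ u v,
      A' y u v + (A y v).comp (A y u) = A' y v u + (A y u).comp (A y v))
    (hr : K * r * (‖z₀‖ + 1) ≤ 1) :
    ∃ Z : E → W, Z 0 = z₀ ∧
      ∀ x ∈ Metric.ball (0 : E) r, HasFDerivAt Z ((A x).flip (Z x)) x := by
  have hcont : ContinuousOn A (Metric.ball 0 r) := fun y hy ↦
    (hA y hy).continuousAt.continuousWithinAt
  have hex : ∀ x : E, ∃ φ : ℝ → W, x ∈ Metric.ball (0 : E) r → (φ 0 = z₀ ∧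
      ∀ t ∈ Icc (0 : ℝ) 1, HasDerivWithinAt φ (A (t • x) x (φ t)) (Icc 0 1) t) := by
    intro x
    by_cases hx : x ∈ Metric.ball (0 : E) r
    · obtain ⟨φ, hφ⟩ := exists_ray_solution hcont hK0 hK hr hx
      exact ⟨φ, fun _ ↦ hφ⟩
    · exact ⟨0, fun h ↦ absurd h hx⟩
  choose φ hφ using hex
  refine ⟨fun x ↦ φ x 1, ?_, ?_⟩
  -- Along the degenerate ray through `0` the velocity vanishes, so the solution is constant.
  · have h0 := hφ 0 (by simpa using hr0)
    have h1 : ∀ t ∈ Icc (0 : ℝ) 1, HasDerivWithinAt (φ 0) 0 (Icc 0 1) t := by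
      intro t ht
      simpa using h0.2 t ht
    have h2 := (convex_Icc (0 : ℝ) 1).norm_image_sub_le_of_norm_hasDerivWithin_le (C := 0)
      (f := φ 0) (f' := fun _ ↦ 0) h1 (by simp) (left_mem_Icc.2 zero_le_one)
      (right_mem_Icc.2 zero_le_one)
    have h3 : φ 0 1 - φ 0 0 = 0 := norm_le_zero_iff.1 (by simpa using h2)
    rw [← h0.1]
    exact sub_eq_zero.1 h3
  intro x hx
  have hmem : ∀ y ∈ Metric.ball (0 : E) r, ∀ t ∈ Icc (0 : ℝ) 1, t • y ∈ Metric.ball (0 : E) r := by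
    intro y hy t ht
    rw [mem_ball_zero_iff] at hy ⊢
    rw [norm_smul, Real.norm_of_nonneg ht.1]
    exact (mul_le_of_le_one_left (norm_nonneg _) ht.2).trans_lt hy
  obtain ⟨hφ0, hφx⟩ := hφ x hx
  have hφc : ContinuousOn (φ x) (Icc 0 1) := fun t ht ↦ (hφx t ht).continuousWithinAt
  -- Only the solution through the fixed `x` needs a bound, so the constant `c` below does not
  -- depend on `y`.
  obtain ⟨m, hm⟩ := isCompact_Icc.exists_bound_of_continuousOn hφc
  set c : ℝ := gronwallBound 0 K 1 1 * ((2 * K + 2 * K ^ 2) * m) with hc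
  have hest : ∀ y ∈ Metric.ball (0 : E) r,
      ‖φ y 1 - φ x 1 - (A x).flip (φ x 1) (y - x)‖ ≤ c * ‖y - x‖ ^ 2 := by
    intro y hy
    obtain ⟨h, rfl⟩ : ∃ h, y = x + h := ⟨y - x, by abel⟩
    obtain ⟨hψ0, hψ⟩ := hφ (x + h) hy
    have hIci : ∀ t ∈ Ico (0 : ℝ) 1, Icc (0 : ℝ) 1 ∈ 𝓝[≥] t := fun t ht ↦
      Filter.mem_of_superset (Icc_mem_nhdsGE ht.2) (Icc_subset_Icc_left ht.1)
    -- If `Z (t • x) = φ x t` and `dZ = A Z`, then moving `t • x` by `t • h` changes `Z` by `t • A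
    -- (t • x) h (φ x t)` to first order; this is the approximate trajectory fed to Grönwall.
    have hder : ∀ t ∈ Icc (0 : ℝ) 1, HasDerivWithinAt (fun t ↦ φ x t + t • A (t • x) h (φ x t))
        (A (t • x) x (φ x t) + (A (t • x) h (φ x t) + t • (A' (t • x) x h (φ x t)
          + A (t • x) h (A (t • x) x (φ x t))))) (Icc 0 1) t := by
      intro t ht
      have hγ : HasDerivWithinAt (fun t : ℝ ↦ t • x) x (Icc 0 1) t := by
        simpa using (hasDerivWithinAt_id t (Icc (0 : ℝ) 1)).smul_const x
      have hAγ : HasDerivWithinAt (fun t : ℝ ↦ A (t • x)) (A' (t • x) x) (Icc 0 1) t :=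
        (hA _ (hmem x hx t ht)).comp_hasDerivWithinAt t hγ
      have h1 : HasDerivWithinAt (fun t : ℝ ↦ A (t • x) h) (A' (t • x) x h) (Icc 0 1) t := by
        simpa using hAγ.clm_apply (hasDerivWithinAt_const t _ h)
      have h2 := h1.clm_apply (hφx t ht)
      have h3 := (hφx t ht).add ((hasDerivWithinAt_id t (Icc (0 : ℝ) 1)).smul h2)
      convert! h3 using 1
      simp only [id, one_smul]
      abel
    have hxn : ‖x‖ ≤ r := (mem_ball_zero_iff.1 hx).le
    have hyn : ‖x + h‖ ≤ r := (mem_ball_zero_iff.1 hy).le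
    have hdiff : ∀ t : ℝ, t • (x + h) - t • x = t • h := fun t ↦ by simp
    have happrox : ∀ t ∈ Ico (0 : ℝ) 1, dist
        (A (t • x) x (φ x t) + (A (t • x) h (φ x t) + t • (A' (t • x) x h (φ x t)
          + A (t • x) h (A (t • x) x (φ x t)))))
        (A (t • (x + h)) (x + h) (φ x t + t • A (t • x) h (φ x t)))
        ≤ (2 * K + 2 * K ^ 2) * m * ‖h‖ ^ 2 := by
      intro t ht
      have ht' := Ico_subset_Icc_self ht
      have hx' := hmem x hx t ht'
      have hy' := hmem _ hy t ht'
      rw [dist_eq_norm]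
      refine ray_error_le hK0 hr1 (hK _ hx') (hK _ hy') (hK' _ hx') ht' hxn hyn ?_ ?_
        (hI _ hx' x h) (hm t ht')
      · have := norm_sub_sub_le_of_lipschitz_deriv (convex_ball (0 : E) r) hK0 hA hL hx' hy'
        rwa [hdiff] at this
      · have := (convex_ball (0 : E) r).norm_image_sub_le_of_norm_hasFDerivWithin_le (f := A)
          (f' := A') (C := K) (fun w hw ↦ (hA w hw).hasFDerivWithinAt) hK' hx' hy'
        rwa [hdiff] at this
    have hgr := dist_le_of_approx_trajectories_ODE_of_mem (K := ⟨K, hK0⟩)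
      (v := fun t ↦ A (t • (x + h)) (x + h)) (s := fun _ ↦ univ) (a := 0) (b := 1)
      (f := fun t ↦ φ x t + t • A (t • x) h (φ x t)) (g := φ (x + h))
      (εg := 0) (δ := 0)
      (fun t ht ↦ (LipschitzWith.weaken (A (t • (x + h)) (x + h)).lipschitz (by
        have h1 := (A (t • (x + h))).le_opNorm (x + h)
        have h2 := hK _ (hmem _ hy t (Ico_subset_Icc_self ht))
        refine h1.trans ?_
        calc ‖A (t • (x + h))‖ * ‖x + h‖ ≤ K * 1 := by gcongr; exact hyn.trans hr1
          _ = K := mul_one K)).lipschitzOnWith)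
      (fun t ht ↦ (hder t ht).continuousWithinAt)
      (fun t ht ↦ (hder t (Ico_subset_Icc_self ht)).mono_of_mem_nhdsWithin (hIci t ht))
      happrox (fun _ _ ↦ mem_univ _)
      (fun t ht ↦ (hψ t ht).continuousWithinAt)
      (fun t ht ↦ (hψ t (Ico_subset_Icc_self ht)).mono_of_mem_nhdsWithin (hIci t ht))
      (fun t _ ↦ by rw [dist_self]) (fun _ _ ↦ mem_univ _) (by simp [hφ0, hψ0]) 1
      (right_mem_Icc.2 zero_le_one)
    rw [dist_comm, dist_eq_norm, gronwallBound_zero_left] at hgr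
    have e : φ (x + h) 1 - φ x 1 - (A x).flip (φ x 1) (x + h - x)
        = φ (x + h) 1 - (φ x 1 + (1 : ℝ) • A ((1 : ℝ) • x) h (φ x 1)) := by
      simp only [one_smul, add_sub_cancel_left, ContinuousLinearMap.flip_apply]
      abel
    rw [e, add_sub_cancel_left, hc]
    refine hgr.trans (le_of_eq ?_)
    change gronwallBound 0 K 1 (1 - 0) * _ = _
    rw [sub_zero, add_zero]
    ring
  refine HasFDerivAt.of_isLittleO ?_
  refine Asymptotics.IsBigO.trans_isLittleO (g := fun y ↦ ‖y - x‖ ^ 2) ?_ ?_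
  · refine Asymptotics.IsBigO.of_bound c ?_
    filter_upwards [Metric.isOpen_ball.mem_nhds hx] with y hy
    simpa using hest y hy
  · exact (Asymptotics.isLittleO_norm_pow_id one_lt_two).comp_tendsto
      (tendsto_sub_nhds_zero_iff.2 Filter.tendsto_id)

/-- Shortcut for instance search. -/
local instance normedGroupHomHom : NormedAddCommGroup (W →L[ℝ] E →L[ℝ] W) :=
  ContinuousLinearMap.toNormedAddCommGroup

/-- Shortcut for instance search. -/
local instance normedSpaceHomHom : NormedSpace ℝ (W →L[ℝ] E →L[ℝ] W) :=
  ContinuousLinearMap.toNormedSpace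

/-- Bootstrapping: the equation expresses the derivative of `Z` through `A` and `Z`, so `Z` being
`C^k` makes its derivative `C^k` as well. -/
theorem contDiffOn_of_hasFDerivAt_flip {A : E → E →L[ℝ] W →L[ℝ] W} {Z : E → W} {s : Set E}
    (hs : IsOpen s) (hA : ContDiffOn ℝ ∞ A s)
    (hZ : ∀ x ∈ s, HasFDerivAt Z ((A x).flip (Z x)) x) : ContDiffOn ℝ ∞ Z s := by
  rw [contDiffOn_infty]
  intro k
  induction k with
  | zero => exact contDiffOn_zero.2 fun x hx ↦ (hZ x hx).continuousAt.continuousWithinAt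
  | succ k ih =>
    rw [Nat.cast_succ]
    refine (contDiffOn_succ_iff_fderiv_of_isOpen hs).2
      ⟨fun x hx ↦ (hZ x hx).differentiableAt.differentiableWithinAt, by simp, ?_⟩
    let L : (E →L[ℝ] W →L[ℝ] W) →L[ℝ] W →L[ℝ] E →L[ℝ] W :=
      (ContinuousLinearMap.flipₗᵢ ℝ E W W).toContinuousLinearEquiv.toContinuousLinearMap
    have h1 : ContDiffOn ℝ k (fun x ↦ (A x).flip) s :=
      L.contDiff.comp_contDiffOn
        (contDiffOn_infty.1 hA k)
    exact (h1.clm_apply ih).congr fun x hx ↦ (hZ x hx).fderiv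

/-- **Frobenius theorem** for a linear total differential equation `dZ = A Z`. -/
theorem exists_hasFDerivAt_of_integrable [CompleteSpace W] {A : E → E →L[ℝ] W →L[ℝ] W}
    {s : Set E} (hs : IsOpen s) (hA : ContDiffOn ℝ ∞ A s)
    (hI : ∀ y ∈ s, ∀ u v, fderiv ℝ A y u v + (A y v).comp (A y u)
      = fderiv ℝ A y v u + (A y u).comp (A y v))
    {x₀ : E} (hx₀ : x₀ ∈ s) (z₀ : W) :
    ∃ Z : E → W, ∃ r > 0, Metric.ball x₀ r ⊆ s ∧ Z x₀ = z₀ ∧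
      ContDiffOn ℝ ∞ Z (Metric.ball x₀ r) ∧
      ∀ x ∈ Metric.ball x₀ r, HasFDerivAt Z ((A x).flip (Z x)) x := by
  have hAx : ContDiffAt ℝ ∞ A x₀ := hA.contDiffAt (hs.mem_nhds hx₀)
  have hA' : ContDiffAt ℝ 1 (fderiv ℝ A) x₀ := hAx.fderiv_right (by norm_num; exact WithTop.coe_le_coe.2 le_top)
  obtain ⟨C, t, ht, hC⟩ := hA'.exists_lipschitzOnWith
  have hb : ∀ᶠ y in 𝓝 x₀, ‖A y‖ < ‖A x₀‖ + 1 :=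
    hAx.continuousAt.norm.eventually_lt continuousAt_const (by simp)
  have hb' : ∀ᶠ y in 𝓝 x₀, ‖fderiv ℝ A y‖ < ‖fderiv ℝ A x₀‖ + 1 :=
    hA'.continuousAt.norm.eventually_lt continuousAt_const (by simp)
  obtain ⟨ε, hε, hball⟩ := Metric.eventually_nhds_iff_ball.1
    ((hs.eventually_mem hx₀).and (Filter.Eventually.and ht (hb.and hb')))
  set K : ℝ := max (C : ℝ) (max (‖A x₀‖ + 1) (‖fderiv ℝ A x₀‖ + 1)) with hKdef
  have hCK : (C : ℝ) ≤ K := le_max_left _ _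
  have hK1 : ‖A x₀‖ + 1 ≤ K := (le_max_left _ _).trans (le_max_right _ _)
  have hK2 : ‖fderiv ℝ A x₀‖ + 1 ≤ K := (le_max_right _ _).trans (le_max_right _ _)
  have hKpos : 0 < K := lt_of_lt_of_le (by positivity) hK1
  -- The radius keeps the ball inside the region where `K` is a common bound and Lipschitz constant,
  -- and makes `K * r * (‖z₀‖ + 1) ≤ 1`.
  set r : ℝ := min ε (min 1 (1 / (K * (‖z₀‖ + 1)))) with hrdef
  have hr0 : 0 < r := lt_min hε (lt_min one_pos (by positivity))
  have hrε : r ≤ ε := min_le_left _ _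
  have hr1 : r ≤ 1 := (min_le_right _ _).trans (min_le_left _ _)
  have hr2 : r ≤ 1 / (K * (‖z₀‖ + 1)) := (min_le_right _ _).trans (min_le_right _ _)
  have hsub : ∀ y ∈ Metric.ball (0 : E) r, x₀ + y ∈ Metric.ball x₀ ε := by
    intro y hy
    rw [mem_ball_zero_iff] at hy
    simpa using hy.trans_le hrε
  obtain ⟨Z, hZ0, hZ⟩ := exists_hasFDerivAt_of_bounds (A := fun y ↦ A (x₀ + y))
    (A' := fun y ↦ fderiv ℝ A (x₀ + y)) (K := K) (r := r) (z₀ := z₀) hKpos.le hr0 hr1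
    (fun y hy ↦ by
      have h1 := ((hA.contDiffAt (hs.mem_nhds (hball _ (hsub y hy)).1)).differentiableAt
        (by simp)).hasFDerivAt
      have h2 : HasFDerivAt (fun y ↦ x₀ + y) (ContinuousLinearMap.id ℝ E) y :=
        (hasFDerivAt_id y).const_add x₀
      simpa using! h1.comp y h2)
    (fun y hy ↦ (hball _ (hsub y hy)).2.2.1.le.trans hK1)
    (fun y hy ↦ (hball _ (hsub y hy)).2.2.2.le.trans hK2)
    (fun y hy z hz ↦ by
      have h1 := hC.norm_sub_le (hball _ (hsub y hy)).2.1 (hball _ (hsub z hz)).2.1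
      rw [add_sub_add_left_eq_sub] at h1
      exact h1.trans (by gcongr))
    (fun y hy ↦ hI _ (hball _ (hsub y hy)).1)
    (by
      rw [le_div_iff₀ (by positivity)] at hr2
      linarith)
  have hZ' : ∀ x ∈ Metric.ball x₀ r,
      HasFDerivAt (fun x ↦ Z (x - x₀)) ((A x).flip (Z (x - x₀))) x := by
    intro x hx
    have hx' : x - x₀ ∈ Metric.ball (0 : E) r := by simpa [dist_eq_norm] using hx
    have h1 := hZ (x - x₀) hx'
    rw [add_sub_cancel] at h1
    have h2 : HasFDerivAt (fun y ↦ y - x₀) (ContinuousLinearMap.id ℝ E) x :=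
      (hasFDerivAt_id x).sub_const x₀
    simpa using! h1.comp x h2
  have hsub' : Metric.ball x₀ r ⊆ s := fun y hy ↦
    (hball y (Metric.ball_subset_ball hrε hy)).1
  exact ⟨fun x ↦ Z (x - x₀), r, hr0, hsub', by simpa using hZ0,
    contDiffOn_of_hasFDerivAt_flip Metric.isOpen_ball (hA.mono hsub') hZ', hZ'⟩

/-- Affine coordinates of a flat torsion-free connection on an open subset of a vector space, given
by its Christoffel symbols `Γ`. -/
theorem exists_affine_coordinates [CompleteSpace E] {Γ : E → E →L[ℝ] E →L[ℝ] E} {s : Set E}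
    (hs : IsOpen s) (hΓ : ContDiffOn ℝ ∞ Γ s) (hsymm : ∀ y ∈ s, ∀ u v, Γ y u v = Γ y v u)
    (hcurv : ∀ y ∈ s, ∀ a b u, fderiv ℝ Γ y a b u + Γ y a (Γ y b u)
      = fderiv ℝ Γ y b a u + Γ y b (Γ y a u)) {x₀ : E} (hx₀ : x₀ ∈ s) :
    ∃ X : E → E, ∃ r > 0, Metric.ball x₀ r ⊆ s ∧ ContDiffOn ℝ ∞ X (Metric.ball x₀ r) ∧
      fderiv ℝ X x₀ = ContinuousLinearMap.id ℝ E ∧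
      ∀ y ∈ Metric.ball x₀ r, ∀ a u, fderiv ℝ (fderiv ℝ X) y a u = fderiv ℝ X y (Γ y a u) := by
  -- The unknown is `Z = (X, ω)`, with `dX = ω` and `dω(a) = ω ∘ Γ(a)`. The maps `C` and `S` encode
  -- the two equations, so that `A y = C + S ∘ Γ y`.
  let V := E × (E →L[ℝ] E)
  let C : E →L[ℝ] V →L[ℝ] V :=
    (ContinuousLinearMap.compL ℝ V E V (ContinuousLinearMap.inl ℝ E (E →L[ℝ] E))).comp
      (((ContinuousLinearMap.compL ℝ V (E →L[ℝ] E) E).flip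
        (ContinuousLinearMap.snd ℝ E (E →L[ℝ] E))).comp (ContinuousLinearMap.apply ℝ E))
  let S : (E →L[ℝ] E) →L[ℝ] V →L[ℝ] V :=
    (ContinuousLinearMap.compL ℝ V (E →L[ℝ] E) V (ContinuousLinearMap.inr ℝ E (E →L[ℝ] E))).comp
      (((ContinuousLinearMap.compL ℝ V (E →L[ℝ] E) (E →L[ℝ] E)).flip
        (ContinuousLinearMap.snd ℝ E (E →L[ℝ] E))).comp (ContinuousLinearMap.compL ℝ E E E).flip)
  have hC : ∀ a z, C a z = (z.2 a, 0) := fun a z ↦ rfl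
  have hS : ∀ g z, S g z = (0, z.2.comp g) := fun g z ↦ rfl
  let A : E → E →L[ℝ] V →L[ℝ] V := fun y ↦ C + S.comp (Γ y)
  have hAapp : ∀ y a z, A y a z = (z.2 a, z.2.comp (Γ y a)) := by
    intro y a z
    change C a z + S (Γ y a) z = _
    rw [hC, hS]
    exact Prod.ext (add_zero _) (zero_add _)
  let T : (E →L[ℝ] E →L[ℝ] E) →L[ℝ] E →L[ℝ] V →L[ℝ] V :=
    ContinuousLinearMap.compL ℝ E (E →L[ℝ] E) (V →L[ℝ] V) S
  have hA : ContDiffOn ℝ ∞ A s :=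
    contDiffOn_const.add (T.contDiff.comp_contDiffOn hΓ)
  have hA' : ∀ y ∈ s, ∀ a b z, fderiv ℝ A y a b z = (0, z.2.comp (fderiv ℝ Γ y a b)) := by
    intro y hy a b z
    have h1 := ((hΓ.contDiffAt (hs.mem_nhds hy)).differentiableAt (by simp)).hasFDerivAt
    have h2 : HasFDerivAt A (T.comp (fderiv ℝ Γ y)) y := (T.hasFDerivAt.comp y h1).const_add C
    rw [h2.fderiv]
    rfl
  -- The first component of the integrability condition is the symmetry of `Γ`, the second the
  -- curvature identity. The initial value `(0, id)` makes `X` a local diffeomorphism at `x₀`.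
  obtain ⟨Z, r, hr, hsub, hZ0, hZc, hZ⟩ := exists_hasFDerivAt_of_integrable hs hA (by
    intro y hy u v
    refine ContinuousLinearMap.ext fun z ↦ ?_
    change fderiv ℝ A y u v z + A y v (A y u z) = fderiv ℝ A y v u z + A y u (A y v z)
    simp only [hA' y hy, hAapp]
    refine Prod.ext ?_ ?_
    · change 0 + z.2 (Γ y u v) = 0 + z.2 (Γ y v u)
      rw [hsymm y hy u v]
    · ext w
      have h := congrArg z.2 (hcurv y hy u v w)
      rw [map_add, map_add] at h
      exact h) hx₀ ((0, ContinuousLinearMap.id ℝ E) : V)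
  have hX : ∀ y ∈ Metric.ball x₀ r, HasFDerivAt (fun y ↦ (Z y).1) (Z y).2 y := by
    intro y hy
    have h := (ContinuousLinearMap.fst ℝ E (E →L[ℝ] E)).hasFDerivAt.comp y (hZ y hy)
    refine h.congr_fderiv ?_
    ext a
    exact congrArg Prod.fst (hAapp y a (Z y))
  have hω : ∀ y ∈ Metric.ball x₀ r, fderiv ℝ (fun y ↦ (Z y).1) y = (Z y).2 :=
    fun y hy ↦ (hX y hy).fderiv
  have hx₀r : x₀ ∈ Metric.ball x₀ r := Metric.mem_ball_self hr
  refine ⟨fun y ↦ (Z y).1, r, hr, hsub, contDiff_fst.comp_contDiffOn hZc, ?_, ?_⟩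
  · rw [hω x₀ hx₀r, hZ0]
  · intro y hy a u
    have hev : fderiv ℝ (fun y ↦ (Z y).1) =ᶠ[𝓝 y] fun y ↦ (Z y).2 := by
      filter_upwards [Metric.isOpen_ball.mem_nhds hy] with w hw using hω w hw
    have h := (ContinuousLinearMap.snd ℝ E (E →L[ℝ] E)).hasFDerivAt.comp y (hZ y hy)
    rw [hev.fderiv_eq, hω y hy]
    have h2 : fderiv ℝ (fun y ↦ (Z y).2) y = _ := h.fderiv
    rw [h2]
    exact congrArg (fun z : V ↦ z.2 u) (hAapp y a (Z y))

end Frobenius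

/-! ### Coordinate fields, Christoffel symbols and changes of chart. -/

section Coordinates

variable {n : ℕ} {M : Type*} [TopologicalSpace M]
  [ChartedSpace (EuclideanSpace ℝ (Fin n)) M] [IsManifold (𝓡 n) ∞ M]
  {c x : OpenPartialHomeomorph M (EuclideanSpace ℝ (Fin n))} {p : M}

theorem mdifferentiable_of_mem_maximalAtlas (hc : c ∈ IsManifold.maximalAtlas (𝓡 n) ∞ M) :
    c.MDifferentiable (𝓡 n) (𝓡 n) :=
  ⟨(contMDiffOn_of_mem_maximalAtlas hc).mdifferentiableOn (by simp),
    (contMDiffOn_symm_of_mem_maximalAtlas hc).mdifferentiableOn (by simp)⟩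

/-- The derivative of a chart at a point, with values in the model space. -/
def chartDeriv (c : OpenPartialHomeomorph M (EuclideanSpace ℝ (Fin n))) (p : M) :
    TangentSpace (𝓡 n) p →L[ℝ] EuclideanSpace ℝ (Fin n) :=
  mfderiv (𝓡 n) (𝓡 n) c p

theorem isInvertible_mfderiv_chart (hc : c ∈ IsManifold.maximalAtlas (𝓡 n) ∞ M)
    (hp : p ∈ c.source) : (mfderiv (𝓡 n) (𝓡 n) c p).IsInvertible :=
  ⟨(mdifferentiable_of_mem_maximalAtlas hc).mfderiv hp, rfl⟩

theorem chartDeriv_coordField (hc : c ∈ IsManifold.maximalAtlas (𝓡 n) ∞ M) (hp : p ∈ c.source)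
    (v : EuclideanSpace ℝ (Fin n)) : chartDeriv c p (coordField c v p) = v :=
  (isInvertible_mfderiv_chart hc hp).self_apply_inverse v

theorem coordField_chartDeriv (hc : c ∈ IsManifold.maximalAtlas (𝓡 n) ∞ M) (hp : p ∈ c.source)
    (v : TangentSpace (𝓡 n) p) : coordField c (chartDeriv c p v) p = v :=
  (isInvertible_mfderiv_chart hc hp).inverse_apply_self v

theorem coordField_add (v w : EuclideanSpace ℝ (Fin n)) :
    coordField c (v + w) p = coordField c v p + coordField c w p :=
  map_add (mfderiv (𝓡 n) (𝓡 n) c p).inverse v w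

theorem coordField_smul (a : ℝ) (v : EuclideanSpace ℝ (Fin n)) :
    coordField c (a • v) p = a • coordField c v p :=
  map_smul (mfderiv (𝓡 n) (𝓡 n) c p).inverse a v

theorem coordField_sum {ι : Type*} (s : Finset ι) (v : ι → EuclideanSpace ℝ (Fin n)) :
    coordField c (∑ i ∈ s, v i) p = ∑ i ∈ s, coordField c (v i) p :=
  map_sum (mfderiv (𝓡 n) (𝓡 n) c p).inverse v s

theorem coordField_zero : coordField c 0 p = 0 :=
  map_zero (mfderiv (𝓡 n) (𝓡 n) c p).inverse

theorem contMDiffAt_coordField (hc : c ∈ IsManifold.maximalAtlas (𝓡 n) ∞ M) (hp : p ∈ c.source)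
    (v : EuclideanSpace ℝ (Fin n)) :
    ContMDiffAt (𝓡 n) (𝓡 n).tangent ∞
      (fun q ↦ (⟨q, coordField c v q⟩ : TangentBundle (𝓡 n) M)) p := by
  refine ContMDiffAt.mpullback_vectorField_preimage (n := ∞) (V := fun _ ↦ v) ?_
    (contMDiffAt_of_mem_maximalAtlas hc hp) (isInvertible_mfderiv_chart hc hp) (by simp)
  exact contMDiffAt_vectorSpace_iff_contDiffAt.2 contDiffAt_const

theorem mdifferentiableAt_coordField (hc : c ∈ IsManifold.maximalAtlas (𝓡 n) ∞ M)
    (hp : p ∈ c.source) (v : EuclideanSpace ℝ (Fin n)) :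
    MDifferentiableAt (𝓡 n) (𝓡 n).tangent
      (fun q ↦ (⟨q, coordField c v q⟩ : TangentBundle (𝓡 n) M)) p :=
  (contMDiffAt_coordField hc hp v).mdifferentiableAt (by simp)

theorem eq_sum_single (v : EuclideanSpace ℝ (Fin n)) :
    v = ∑ i, v i • EuclideanSpace.single i (1 : ℝ) := by
  conv_lhs => rw [← (EuclideanSpace.basisFun (Fin n) ℝ).sum_repr v]
  simp

theorem coordField_eq_sum (v : EuclideanSpace ℝ (Fin n)) :
    coordField c v p = ∑ i, v i • coordField c (EuclideanSpace.single i 1) p := by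
  conv_lhs => rw [eq_sum_single v]
  simp only [coordField_sum, coordField_smul]

section Connection

variable (D : Connection n M)

theorem connection_sum {ι : Type*} (s : Finset ι) (σ : ι → ∀ q : M, TangentSpace (𝓡 n) q)
    (hσ : ∀ i ∈ s, MDifferentiableAt (𝓡 n) (𝓡 n).tangent
      (fun q ↦ (⟨q, σ i q⟩ : TangentBundle (𝓡 n) M)) p) :
    D (∑ i ∈ s, σ i) p = ∑ i ∈ s, D (σ i) p := by
  classical
  induction s using Finset.induction_on with
  | empty => simp
  | insert a s ha ih =>
    rw [Finset.sum_insert ha, Finset.sum_insert ha, ← ih fun i hi ↦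
      hσ i (Finset.mem_insert_of_mem hi)]
    refine D.isCovariantDerivativeOnUniv.add (hσ a (Finset.mem_insert_self a s)) ?_
    have := MDifferentiableAt.sum_section (s := s) (t := σ) (x₀ := p)
      fun i hi ↦ hσ i (Finset.mem_insert_of_mem hi)
    convert! this using 3
    simp

/-- Leibniz rule for a field with coefficients `G` in the frame of a chart. -/
theorem connection_coordField_apply (hc : c ∈ IsManifold.maximalAtlas (𝓡 n) ∞ M)
    (hp : p ∈ c.source) {G : M → EuclideanSpace ℝ (Fin n)}
    {G' : TangentSpace (𝓡 n) p →L[ℝ] EuclideanSpace ℝ (Fin n)}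
    (hG : HasMFDerivAt (𝓡 n) 𝓘(ℝ, EuclideanSpace ℝ (Fin n)) G p G') (v : TangentSpace (𝓡 n) p) :
    D (fun q ↦ coordField c (G q) q) p v
      = ∑ i, G p i • D (coordField c (EuclideanSpace.single i 1)) p v + coordField c (G' v) p := by
  have hsum : (fun q ↦ coordField c (G q) q)
      = ∑ i, (fun q ↦ G q i) • coordField c (EuclideanSpace.single i (1 : ℝ)) := by
    funext q
    rw [coordField_eq_sum]
    simp
  have hGi : ∀ i, HasMFDerivAt (𝓡 n) 𝓘(ℝ, ℝ) (fun q ↦ G q i) p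
      ((EuclideanSpace.proj i : EuclideanSpace ℝ (Fin n) →L[ℝ] ℝ).comp G') := fun i ↦
    ((EuclideanSpace.proj i : EuclideanSpace ℝ (Fin n) →L[ℝ] ℝ).hasMFDerivAt).comp p hG
  have hC := fun i ↦ mdifferentiableAt_coordField hc hp (EuclideanSpace.single i (1 : ℝ))
  rw [hsum, connection_sum D Finset.univ _ fun i _ ↦
    (hGi i).mdifferentiableAt.smul_section (hC i)]
  rw [coordField_eq_sum (G' v), ← Finset.sum_add_distrib, sum_apply]
  refine Finset.sum_congr rfl fun i _ ↦ ?_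
  rw [D.isCovariantDerivativeOnUniv.leibniz (hC i) (hGi i).mdifferentiableAt]
  have h1 : mvfderiv (𝓡 n) (fun q ↦ G q i) p v = G' v i := by
    rw [mvfderiv, (hGi i).mfderiv]
    rfl
  rw [← h1]
  rfl

theorem connection_coordField_eq_sum (hc : c ∈ IsManifold.maximalAtlas (𝓡 n) ∞ M)
    (hp : p ∈ c.source) (u : EuclideanSpace ℝ (Fin n)) (v : TangentSpace (𝓡 n) p) :
    D (coordField c u) p v
      = ∑ i, u i • D (coordField c (EuclideanSpace.single i 1)) p v := by
  have h := connection_coordField_apply D hc hp (G := fun _ ↦ u) (hasMFDerivAt_const u p) v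
  refine h.trans ?_
  have h0 : coordField c ((0 : TangentSpace (𝓡 n) p →L[ℝ] EuclideanSpace ℝ (Fin n)) v) p = 0 :=
    coordField_zero
  exact (congrArg _ h0).trans (add_zero _)

/-- Freezing the coefficients at `p` loses only their derivative. The change of chart formula and
the curvature computation both rest on this form of the Leibniz rule. -/
theorem connection_coordField (hc : c ∈ IsManifold.maximalAtlas (𝓡 n) ∞ M)
    (hp : p ∈ c.source) {G : M → EuclideanSpace ℝ (Fin n)}
    {G' : TangentSpace (𝓡 n) p →L[ℝ] EuclideanSpace ℝ (Fin n)}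
    (hG : HasMFDerivAt (𝓡 n) 𝓘(ℝ, EuclideanSpace ℝ (Fin n)) G p G') (v : TangentSpace (𝓡 n) p) :
    D (fun q ↦ coordField c (G q) q) p v
      = D (coordField c (G p)) p v + coordField c (G' v) p := by
  rw [connection_coordField_apply D hc hp hG, connection_coordField_eq_sum D hc hp (G p)]

/-- The Christoffel symbols of a connection in the chart `c`, as a bilinear map:
`christoffel D c y a u` stands for `∇_{a} u`, where `a` and `u` are constant in the chart. -/
def christoffel (c : OpenPartialHomeomorph M (EuclideanSpace ℝ (Fin n)))
    (y : EuclideanSpace ℝ (Fin n)) :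
    EuclideanSpace ℝ (Fin n) →L[ℝ] EuclideanSpace ℝ (Fin n) →L[ℝ] EuclideanSpace ℝ (Fin n) :=
  ∑ j, (ContinuousLinearMap.smulRightL ℝ (EuclideanSpace ℝ (Fin n)) (EuclideanSpace ℝ (Fin n))
      (EuclideanSpace.proj j)).comp
    ((chartDeriv c (c.symm y)).comp
      ((D (coordField c (EuclideanSpace.single j 1)) (c.symm y)).comp
        (chartDeriv c (c.symm y)).inverse))

theorem christoffel_apply_eq_sum (y a u : EuclideanSpace ℝ (Fin n)) :
    christoffel D c y a u = ∑ j, u j • (chartDeriv c (c.symm y)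
      (D (coordField c (EuclideanSpace.single j 1)) (c.symm y) (coordField c a (c.symm y)))) := by
  rw [christoffel, sum_apply, sum_apply]
  rfl

theorem connection_coordField_eq_christoffel (hc : c ∈ IsManifold.maximalAtlas (𝓡 n) ∞ M)
    (hp : p ∈ c.source) (u : EuclideanSpace ℝ (Fin n)) (v : TangentSpace (𝓡 n) p) :
    D (coordField c u) p v
      = coordField c (christoffel D c (c p) (chartDeriv c p v) u) p := by
  rw [christoffel_apply_eq_sum, c.left_inv hp, connection_coordField_eq_sum D hc hp,
    coordField_sum]
  refine Finset.sum_congr rfl fun j _ ↦ ?_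
  rw [coordField_smul, coordField_chartDeriv hc hp, coordField_chartDeriv hc hp]

end Connection

theorem contDiffOn_chart_change (hc : c ∈ IsManifold.maximalAtlas (𝓡 n) ∞ M)
    (hx : x ∈ IsManifold.maximalAtlas (𝓡 n) ∞ M) :
    ContDiffOn ℝ ∞ (x ∘ c.symm) (c.target ∩ c.symm ⁻¹' x.source) := by
  rw [← contMDiffOn_iff_contDiffOn]
  exact (contMDiffOn_of_mem_maximalAtlas hx).comp'
    (contMDiffOn_symm_of_mem_maximalAtlas hc)

theorem isOpen_chart_change_domain : IsOpen (c.target ∩ c.symm ⁻¹' x.source) :=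
  c.isOpen_inter_preimage_symm x.open_source

theorem contDiffAt_chart_change (hc : c ∈ IsManifold.maximalAtlas (𝓡 n) ∞ M)
    (hx : x ∈ IsManifold.maximalAtlas (𝓡 n) ∞ M) (hpc : p ∈ c.source) (hpx : p ∈ x.source) :
    ContDiffAt ℝ ∞ (x ∘ c.symm) (c p) :=
  (contDiffOn_chart_change hc hx).contDiffAt (isOpen_chart_change_domain.mem_nhds
    ⟨c.map_source hpc, by rwa [mem_preimage, c.left_inv hpc]⟩)

theorem chartDeriv_eq (hc : c ∈ IsManifold.maximalAtlas (𝓡 n) ∞ M)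
    (hx : x ∈ IsManifold.maximalAtlas (𝓡 n) ∞ M) (hpc : p ∈ c.source) (hpx : p ∈ x.source)
    (v : TangentSpace (𝓡 n) p) :
    chartDeriv x p v = fderiv ℝ (x ∘ c.symm) (c p) (chartDeriv c p v) := by
  have h1 : HasMFDerivAt (𝓡 n) (𝓡 n) (x ∘ c.symm) (c p) (fderiv ℝ (x ∘ c.symm) (c p)) :=
    ((contDiffAt_chart_change hc hx hpc hpx).differentiableAt (by simp)).hasFDerivAt.hasMFDerivAt
  have h2 := h1.comp p ((mdifferentiable_of_mem_maximalAtlas hc).mdifferentiableAt hpc).hasMFDerivAt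
  have h3 : x =ᶠ[𝓝 p] (x ∘ c.symm) ∘ c := by
    filter_upwards [c.open_source.mem_nhds hpc] with q hq
    simp [c.left_inv hq]
  rw [chartDeriv, (h2.congr_of_eventuallyEq h3).mfderiv]
  rfl

theorem coordField_chart_change (hc : c ∈ IsManifold.maximalAtlas (𝓡 n) ∞ M)
    (hx : x ∈ IsManifold.maximalAtlas (𝓡 n) ∞ M) (hpc : p ∈ c.source) (hpx : p ∈ x.source)
    (u : EuclideanSpace ℝ (Fin n)) :
    coordField x (fderiv ℝ (x ∘ c.symm) (c p) u) p = coordField c u p := by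
  have h := chartDeriv_eq hc hx hpc hpx (coordField c u p)
  rw [chartDeriv_coordField hc hpc] at h
  rw [← h, coordField_chartDeriv hx hpx]

/-- Transformation of the covariant derivatives of coordinate fields under a change of chart. -/
theorem connection_chart_change (D : Connection n M) (hc : c ∈ IsManifold.maximalAtlas (𝓡 n) ∞ M)
    (hx : x ∈ IsManifold.maximalAtlas (𝓡 n) ∞ M) (hpc : p ∈ c.source) (hpx : p ∈ x.source)
    (u : EuclideanSpace ℝ (Fin n)) (v : TangentSpace (𝓡 n) p) :
    D (coordField c u) p v = D (coordField x (fderiv ℝ (x ∘ c.symm) (c p) u)) p v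
      + coordField x (fderiv ℝ (fderiv ℝ (x ∘ c.symm)) (c p)
          (chartDeriv c p v) u) p := by
  have hψ := contDiffAt_chart_change hc hx hpc hpx
  have h1 : HasFDerivAt (fun y ↦ fderiv ℝ (x ∘ c.symm) y u)
      ((fderiv ℝ (fderiv ℝ (x ∘ c.symm)) (c p)).flip u) (c p) := by
    have h2 : DifferentiableAt ℝ (fderiv ℝ (x ∘ c.symm)) (c p) :=
      (hψ.fderiv_right (m := ∞) (by simp)).differentiableAt (by simp)
    have h3 := h2.hasFDerivAt.clm_apply (hasFDerivAt_const u (c p))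
    refine h3.congr_fderiv ?_
    ext w
    simp
  have hG := h1.hasMFDerivAt.comp p
    ((mdifferentiable_of_mem_maximalAtlas hc).mdifferentiableAt hpc).hasMFDerivAt
  -- A field constant in `c` has coefficients `fderiv ℝ (x ∘ c.symm) (c q) u` in the frame of `x`;
  -- differentiating them gives the second derivative term.
  have hev : ∀ᶠ q in 𝓝 p, coordField c u q
      = coordField x (fderiv ℝ (x ∘ c.symm) (c q) u) q := by
    filter_upwards [c.open_source.mem_nhds hpc, x.open_source.mem_nhds hpx] with q hqc hqx
    rw [coordField_chart_change hc hx hqc hqx]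
  have hd := mdifferentiableAt_coordField hc hpc u
  have hd' : MDifferentiableAt (𝓡 n) (𝓡 n).tangent (fun q ↦
      (⟨q, coordField x (fderiv ℝ (x ∘ c.symm) (c q) u) q⟩ : TangentBundle (𝓡 n) M)) p := by
    refine hd.congr_of_eventuallyEq ?_
    filter_upwards [hev] with q hq
    rw [hq]
  rw [D.isCovariantDerivativeOnUniv.congr_of_eventuallyEq hd hd' Filter.univ_mem hev]
  exact connection_coordField D hx hpx hG v

end Coordinates

/-! ### Flatness in terms of Christoffel symbols. -/

section FlatConnection

variable {n : ℕ} {M : Type*} [TopologicalSpace M]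
  [ChartedSpace (EuclideanSpace ℝ (Fin n)) M] [IsManifold (𝓡 n) ∞ M]
  {c x : OpenPartialHomeomorph M (EuclideanSpace ℝ (Fin n))} {p : M}

attribute [local instance] normedGroupEnd normedSpaceEnd normedGroupHomEnd normedSpaceHomEnd

/-- A bump function extends the field. Smoothness of the connection and vanishing of its curvature
are available for global smooth fields, while coordinate fields are controlled only on the chart
domain. -/
theorem exists_isSmoothField_eventuallyEq_coordField [T2Space M]
    (hc : c ∈ IsManifold.maximalAtlas (𝓡 n) ∞ M) (hp : p ∈ c.source)
    (v : EuclideanSpace ℝ (Fin n)) :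
    ∃ X : ∀ q : M, TangentSpace (𝓡 n) q, IsSmoothField X ∧ ∀ᶠ q in 𝓝 p, X q = coordField c v q := by
  obtain ⟨ρ, -, hρ⟩ := (SmoothBumpFunction.nhds_basis_tsupport (I := 𝓡 n) p).mem_iff.1
    (c.open_source.mem_nhds hp)
  refine ⟨(ρ : M → ℝ) • coordField c v, ?_, ?_⟩
  · exact ContMDiffOn.smul_section_of_tsupport (n := ∞) ρ.contMDiff.contMDiffOn c.open_source hρ
      fun q hq ↦ (contMDiffAt_coordField hc hq v).contMDiffWithinAt
  · filter_upwards [ρ.eventuallyEq_one] with q hq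
    change ρ q • coordField c v q = _
    rw [hq]
    exact one_smul ℝ _

theorem contMDiffAt_chartDeriv_apply (hc : c ∈ IsManifold.maximalAtlas (𝓡 n) ∞ M)
    (hp : p ∈ c.source) {σ : ∀ q : M, TangentSpace (𝓡 n) q}
    (hσ : ContMDiffAt (𝓡 n) (𝓡 n).tangent ∞ (fun q ↦ (⟨q, σ q⟩ : TangentBundle (𝓡 n) M)) p) :
    ContMDiffAt (𝓡 n) 𝓘(ℝ, EuclideanSpace ℝ (Fin n)) ∞ (fun q ↦ chartDeriv c q (σ q)) p := by
  have h1 := (contMDiffOn_of_mem_maximalAtlas hc).contMDiffOn_tangentMapWithin (m := ∞) (by simp)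
    c.open_source.uniqueMDiffOn
  have hopen : IsOpen (π (EuclideanSpace ℝ (Fin n)) (TangentSpace (𝓡 n) (M := M)) ⁻¹' c.source) :=
    c.open_source.preimage (FiberBundle.continuous_proj _ _)
  have h2 := (h1 (⟨p, σ p⟩ : TangentBundle (𝓡 n) M) hp).contMDiffAt (hopen.mem_nhds hp)
  have h3 := (contMDiff_snd_tangentBundle_modelSpace (EuclideanSpace ℝ (Fin n)) (𝓡 n)
    (n := ∞)).contMDiffAt.comp p (h2.comp p hσ)
  refine h3.congr_of_eventuallyEq ?_
  filter_upwards [c.open_source.mem_nhds hp] with q hq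
  change mfderiv (𝓡 n) (𝓡 n) c q (σ q) = mfderivWithin (𝓡 n) (𝓡 n) c c.source q (σ q)
  rw [mfderivWithin_of_isOpen c.open_source hq]

variable {D : Connection n M}

theorem connection_congr {σ τ : ∀ q : M, TangentSpace (𝓡 n) q}
    (hσ : MDifferentiableAt (𝓡 n) (𝓡 n).tangent (fun q ↦ (⟨q, σ q⟩ : TangentBundle (𝓡 n) M)) p)
    (h : ∀ᶠ q in 𝓝 p, σ q = τ q) : D σ p = D τ p := by
  refine D.isCovariantDerivativeOnUniv.congr_of_eventuallyEq hσ ?_ Filter.univ_mem h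
  refine hσ.congr_of_eventuallyEq ?_
  filter_upwards [h] with q hq
  rw [hq]

theorem contMDiffAt_nabla_coordField [T2Space M] (hD : D.ContMDiffCovariantDerivative ∞)
    (hc : c ∈ IsManifold.maximalAtlas (𝓡 n) ∞ M) (hp : p ∈ c.source)
    (a u : EuclideanSpace ℝ (Fin n)) :
    ContMDiffAt (𝓡 n) (𝓡 n).tangent ∞
      (fun q ↦ (⟨q, D (coordField c u) q (coordField c a q)⟩ : TangentBundle (𝓡 n) M)) p := by
  obtain ⟨X, hX, hXc⟩ := exists_isSmoothField_eventuallyEq_coordField hc hp u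
  have h1 := hD.contMDiff.contMDiff (σ := X) (by
    have h := hX.contMDiffOn (s := univ)
    exact h)
  have h2 := ((h1 p (mem_univ p)).contMDiffAt Filter.univ_mem).clm_bundle_apply
    (contMDiffAt_coordField hc hp a)
  refine h2.congr_of_eventuallyEq ?_
  filter_upwards [hXc.eventually_nhds] with q hq
  rw [connection_congr (hX.mdifferentiableAt (by simp)) hq]

theorem chartDeriv_nabla_coordField (hc : c ∈ IsManifold.maximalAtlas (𝓡 n) ∞ M)
    (hp : p ∈ c.source) (a u : EuclideanSpace ℝ (Fin n)) :
    chartDeriv c p (D (coordField c u) p (coordField c a p)) = christoffel D c (c p) a u := by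
  rw [connection_coordField_eq_christoffel D hc hp, chartDeriv_coordField hc hp,
    chartDeriv_coordField hc hp]

theorem contDiffOn_christoffel [T2Space M] (hD : D.ContMDiffCovariantDerivative ∞)
    (hc : c ∈ IsManifold.maximalAtlas (𝓡 n) ∞ M) :
    ContDiffOn ℝ ∞ (christoffel D c) c.target := by
  refine contDiffOn_clm_apply.2 fun a ↦ contDiffOn_clm_apply.2 fun u ↦ ?_
  rw [← contMDiffOn_iff_contDiffOn]
  intro y hy
  have hp := c.map_target hy
  have h1 := contMDiffAt_chartDeriv_apply hc hp (contMDiffAt_nabla_coordField hD hc hp a u)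
  have h2 := h1.comp y (contMDiffAt_symm_of_mem_maximalAtlas hc hy)
  refine (h2.congr_of_eventuallyEq ?_).contMDiffWithinAt
  filter_upwards [c.open_target.mem_nhds hy] with z hz
  change _ = chartDeriv c (c.symm z) (D (coordField c u) (c.symm z) (coordField c a (c.symm z)))
  rw [chartDeriv_nabla_coordField hc (c.map_target hz), c.right_inv hz]

/-- Pullback by the chart commutes with brackets, and constant fields commute. -/
theorem mlieBracket_coordField (hc : c ∈ IsManifold.maximalAtlas (𝓡 n) ∞ M) (hp : p ∈ c.source)
    (a b : EuclideanSpace ℝ (Fin n)) :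
    VectorField.mlieBracket (𝓡 n) (coordField c a) (coordField c b) p = 0 := by
  have hconst : ∀ v : EuclideanSpace ℝ (Fin n), MDifferentiableAt (𝓡 n) (𝓡 n).tangent
      (fun y ↦ (⟨y, v⟩ : TangentBundle (𝓡 n) (EuclideanSpace ℝ (Fin n)))) (c p) := fun v ↦
    (contMDiffAt_vectorSpace_iff_contDiffAt (n := 1) (V := fun _ ↦ v).2
      contDiffAt_const).mdifferentiableAt (by simp)
  have h2 : (2 : ℕ∞ω) ≤ ∞ := WithTop.coe_le_coe.2 le_top
  have : IsManifold (𝓡 n) (minSmoothness ℝ 2) M := by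
    rw [minSmoothness_of_isRCLikeNormedField]
    exact IsManifold.of_le h2
  have h := VectorField.mpullback_mlieBracket (I := 𝓡 n) (I' := 𝓡 n) (n := ∞) (f := c) (x₀ := p)
    (V := fun _ ↦ a) (W := fun _ ↦ b) (hconst a) (hconst b)
    (contMDiffAt_of_mem_maximalAtlas hc hp) (by simpa using h2)
  refine h.symm.trans ?_
  have h0 := congrFun (VectorField.mlieBracketWithin_eq_lieBracketWithin (𝕜 := ℝ)
    (V := fun _ : EuclideanSpace ℝ (Fin n) ↦ a) (W := fun _ ↦ b) (s := univ)) (c p)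
  have h1 : VectorField.lieBracketWithin ℝ (fun _ : EuclideanSpace ℝ (Fin n) ↦ a) (fun _ ↦ b) univ
      (c p) = 0 := by
    simp [VectorField.lieBracketWithin]
  exact (congrArg (mfderiv (𝓡 n) (𝓡 n) c p).inverse (h0.trans h1)).trans (map_zero _)

theorem IsFlat.christoffel_symm (hD : IsFlat D) (hc : c ∈ IsManifold.maximalAtlas (𝓡 n) ∞ M)
    {y : EuclideanSpace ℝ (Fin n)} (hy : y ∈ c.target) (a b : EuclideanSpace ℝ (Fin n)) :
    christoffel D c y a b = christoffel D c y b a := by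
  have hp := c.map_target hy
  have h := D.torsion_apply (mdifferentiableAt_coordField hc hp a)
    (mdifferentiableAt_coordField hc hp b)
  rw [hD.torsion_eq_zero, mlieBracket_coordField hc hp, sub_zero] at h
  have h1 := sub_eq_zero.1 h.symm
  rw [← c.right_inv hy, ← chartDeriv_nabla_coordField hc hp, ← chartDeriv_nabla_coordField hc hp,
    h1]

/-- The inner derivative is a field with coefficients `Γ(b, u)` in the frame of `c`. The Leibniz
rule differentiates these coefficients and applies `Γ` to them once more. -/
theorem nabla_nabla_coordField [T2Space M] (hD : D.ContMDiffCovariantDerivative ∞)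
    (hc : c ∈ IsManifold.maximalAtlas (𝓡 n) ∞ M) (hp : p ∈ c.source)
    (a b u : EuclideanSpace ℝ (Fin n)) :
    D (fun q ↦ D (coordField c u) q (coordField c b q)) p (coordField c a p)
      = coordField c (fderiv ℝ (christoffel D c) (c p) a b u
          + christoffel D c (c p) a (christoffel D c (c p) b u)) p := by
  have hev : ∀ᶠ q in 𝓝 p, D (coordField c u) q (coordField c b q)
      = coordField c (christoffel D c (c q) b u) q := by
    filter_upwards [c.open_source.mem_nhds hp] with q hq
    rw [connection_coordField_eq_christoffel D hc hq, chartDeriv_coordField hc hq]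
  rw [connection_congr ((contMDiffAt_nabla_coordField hD hc hp b u).mdifferentiableAt (by simp))
    hev]
  let L : (EuclideanSpace ℝ (Fin n) →L[ℝ] EuclideanSpace ℝ (Fin n) →L[ℝ]
      EuclideanSpace ℝ (Fin n)) →L[ℝ] EuclideanSpace ℝ (Fin n) :=
    (ContinuousLinearMap.apply ℝ (EuclideanSpace ℝ (Fin n)) u).comp
      (ContinuousLinearMap.apply ℝ (EuclideanSpace ℝ (Fin n) →L[ℝ] EuclideanSpace ℝ (Fin n)) b)
  have h1 : HasFDerivAt (fun y ↦ christoffel D c y b u)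
      (L.comp (fderiv ℝ (christoffel D c) (c p))) (c p) :=
    L.hasFDerivAt.comp (c p) (((contDiffOn_christoffel hD hc).contDiffAt
      (c.open_target.mem_nhds (c.map_source hp))).differentiableAt (by simp)).hasFDerivAt
  have hG := h1.hasMFDerivAt.comp p
    ((mdifferentiable_of_mem_maximalAtlas hc).mdifferentiableAt hp).hasMFDerivAt
  have h2 := connection_coordField D hc hp hG (coordField c a p)
  refine h2.trans ?_
  rw [coordField_add, add_comm]
  congr 1
  · change coordField c (fderiv ℝ (christoffel D c) (c p) (chartDeriv c p (coordField c a p)) b u) p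
      = _
    rw [chartDeriv_coordField hc hp]
  · change D (coordField c (christoffel D c (c p) b u)) p (coordField c a p) = _
    rw [connection_coordField_eq_christoffel D hc hp, chartDeriv_coordField hc hp]

theorem IsFlat.christoffel_curvature [T2Space M] (hflat : IsFlat D)
    (hD : D.ContMDiffCovariantDerivative ∞) (hc : c ∈ IsManifold.maximalAtlas (𝓡 n) ∞ M)
    {y : EuclideanSpace ℝ (Fin n)} (hy : y ∈ c.target) (a b u : EuclideanSpace ℝ (Fin n)) :
    fderiv ℝ (christoffel D c) y a b u + christoffel D c y a (christoffel D c y b u)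
      = fderiv ℝ (christoffel D c) y b a u + christoffel D c y b (christoffel D c y a u) := by
  have hp := c.map_target hy
  set p := c.symm y with hpdef
  obtain ⟨X, hX, hXc⟩ := exists_isSmoothField_eventuallyEq_coordField hc hp a
  obtain ⟨Y, hY, hYc⟩ := exists_isSmoothField_eventuallyEq_coordField hc hp b
  obtain ⟨Z, hZ, hZc⟩ := exists_isSmoothField_eventuallyEq_coordField hc hp u
  have key : ∀ {X Y : ∀ q : M, TangentSpace (𝓡 n) q} {a b : EuclideanSpace ℝ (Fin n)},
      (∀ᶠ q in 𝓝 p, X q = coordField c a q) → (∀ᶠ q in 𝓝 p, Y q = coordField c b q) →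
      nabla D X (nabla D Y Z) p = coordField c (fderiv ℝ (christoffel D c) (c p) a b u
          + christoffel D c (c p) a (christoffel D c (c p) b u)) p := by
    intro X Y a b hXc hYc
    rw [← nabla_nabla_coordField hD hc hp, nabla, hXc.self_of_nhds]
    refine congrArg (fun L : TangentSpace (𝓡 n) p →L[ℝ] TangentSpace (𝓡 n) p ↦
      L (coordField c a p)) (Eq.symm ?_)
    refine connection_congr
      ((contMDiffAt_nabla_coordField hD hc hp b u).mdifferentiableAt (by simp)) ?_
    filter_upwards [hYc, hZc.eventually_nhds] with q hqY hqZ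
    rw [nabla, hqY, connection_congr (hZ.mdifferentiableAt (by simp)) hqZ]
  -- The bracket depends only on germs, so it vanishes at `p` and the last curvature term drops out.
  have hbr : VectorField.mlieBracket (𝓡 n) X Y p = 0 := by
    rw [Filter.EventuallyEq.mlieBracket_vectorField_eq hXc hYc, mlieBracket_coordField hc hp]
  have h := hflat.curvature_eq_zero X Y Z hX hY hZ p
  rw [curvature, key hXc hYc, key hYc hXc, nabla, hbr, map_zero, sub_zero, sub_eq_zero] at h
  have h2 := congrArg (chartDeriv c p) h
  rwa [chartDeriv_coordField hc hp, chartDeriv_coordField hc hp, hpdef, c.right_inv hy] at h2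

end FlatConnection

/-! ### Existence of affine charts. -/

theorem exists_openPartialHomeomorph_of_contDiffOn {E : Type*} [NormedAddCommGroup E]
    [NormedSpace ℝ E] [CompleteSpace E] {X : E → E} {U : Set E} (hU : IsOpen U)
    (hX : ContDiffOn ℝ ∞ X U) {x₀ : E} (hx₀ : x₀ ∈ U)
    (hX' : fderiv ℝ X x₀ = ContinuousLinearMap.id ℝ E) :
    ∃ e : OpenPartialHomeomorph E E, x₀ ∈ e.source ∧ e.source ⊆ U ∧ (e : E → E) = X ∧
      ContDiffOn ℝ ∞ e.symm e.target ∧ ∀ y ∈ e.source, Function.Surjective (fderiv ℝ X y) := by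
  have hXat : ∀ y ∈ U, ContDiffAt ℝ ∞ X y := fun y hy ↦ hX.contDiffAt (hU.mem_nhds hy)
  have hder : HasFDerivAt X ((ContinuousLinearEquiv.refl ℝ E : E ≃L[ℝ] E) : E →L[ℝ] E) x₀ := by
    have h := ((hXat x₀ hx₀).differentiableAt (by simp)).hasFDerivAt
    rw [hX'] at h
    exact h
  let e₀ := (hXat x₀ hx₀).toOpenPartialHomeomorph X hder (by simp)
  have he₀ : (e₀ : E → E) = X := rfl
  -- Restricting to the open set where the derivative is invertible makes the inverse smooth on the
  -- whole target, not merely near the image of `x₀`.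
  let V : Set E := U ∩ fderiv ℝ X ⁻¹' range ((↑) : (E ≃L[ℝ] E) → E →L[ℝ] E)
  have hV : IsOpen V := (hX.continuousOn_fderiv_of_isOpen hU (by simp)).isOpen_inter_preimage hU
    ContinuousLinearEquiv.isOpen
  have hx₀V : x₀ ∈ V := ⟨hx₀, ContinuousLinearEquiv.refl ℝ E, hX'.symm⟩
  refine ⟨e₀.restrOpen V hV,
    ⟨(hXat x₀ hx₀).mem_toOpenPartialHomeomorph_source hder (by simp), hx₀V⟩,
    fun y hy ↦ hy.2.1, he₀, ?_, ?_⟩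
  · intro z hz
    have hy := (e₀.restrOpen V hV).map_target hz
    obtain ⟨L, hL⟩ := hy.2.2
    have hat := hXat _ hy.2.1
    have hd := (hat.differentiableAt (by simp)).hasFDerivAt
    rw [← hL] at hd
    exact ((e₀.restrOpen V hV).contDiffAt_symm hz hd hat).contDiffWithinAt
  · rintro y ⟨-, -, L, hL⟩
    rw [← hL]
    exact L.surjective

section AffineChart

variable {n : ℕ} {M : Type*} [TopologicalSpace M]
  [ChartedSpace (EuclideanSpace ℝ (Fin n)) M] [IsManifold (𝓡 n) ∞ M]
  {c x : OpenPartialHomeomorph M (EuclideanSpace ℝ (Fin n))} {p : M} {D : Connection n M}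

theorem IsAffineChart.connection_coordField_eq_zero (hx : IsAffineChart D x) (hp : p ∈ x.source)
    (u : EuclideanSpace ℝ (Fin n)) : D (coordField x u) p = 0 := by
  ext1 v
  rw [connection_coordField_eq_sum D hx.mem_maximalAtlas hp, zero_apply]
  refine Finset.sum_eq_zero fun j _ ↦ ?_
  have hv := coordField_chartDeriv hx.mem_maximalAtlas hp v
  rw [coordField_eq_sum] at hv
  rw [← hv, map_sum]
  refine smul_eq_zero_of_right _ (Finset.sum_eq_zero fun i _ ↦ ?_)
  rw [map_smul]
  exact smul_eq_zero_of_right _ (hx.nabla_eq_zero i j p hp)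

theorem isAffineChart_of_connection_eq_zero (hx : x ∈ IsManifold.maximalAtlas (𝓡 n) ∞ M)
    (h : ∀ p ∈ x.source, ∀ u, D (coordField x u) p = 0) : IsAffineChart D x :=
  ⟨hx, fun i j p hp ↦ by rw [nabla, h p hp, zero_apply]⟩

/-- Coordinate fields depend only on the underlying map of the chart, which restriction keeps. -/
theorem IsAffineChart.restrOpen (hx : IsAffineChart D x) {U : Set M} (hU : IsOpen U) :
    IsAffineChart D (x.restrOpen U hU) := by
  refine ⟨?_, fun i j p hp ↦ hx.nabla_eq_zero i j p hp.1⟩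
  exact (x.restrOpen U hU).mem_maximalAtlas_of_contMDiffOn
    ((contMDiffOn_of_mem_maximalAtlas hx.mem_maximalAtlas).mono inter_subset_left)
    ((contMDiffOn_symm_of_mem_maximalAtlas hx.mem_maximalAtlas).mono inter_subset_left)

/-- A flat torsion-free connection has affine coordinates near every point. -/
theorem exists_isAffineChart [T2Space M] (hD : D.ContMDiffCovariantDerivative ∞)
    (hflat : IsFlat D) (p : M) : ∃ x, IsAffineChart D x ∧ p ∈ x.source := by
  set c := chartAt (EuclideanSpace ℝ (Fin n)) p
  have hc : c ∈ IsManifold.maximalAtlas (𝓡 n) ∞ M := IsManifold.chart_mem_maximalAtlas p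
  have hp : p ∈ c.source := mem_chart_source _ p
  obtain ⟨X, r, hr, hrt, hX, hX0, hX2⟩ := exists_affine_coordinates c.open_target
    (contDiffOn_christoffel hD hc) (fun y hy ↦ hflat.christoffel_symm hc hy)
    (fun y hy ↦ hflat.christoffel_curvature hD hc hy) (c.map_source hp)
  obtain ⟨e, hpe, her, heX, he', hesurj⟩ := exists_openPartialHomeomorph_of_contDiffOn
    Metric.isOpen_ball hX (Metric.mem_ball_self hr) hX0
  have hesm : ContDiffOn ℝ ∞ e e.source := heX ▸ hX.mono her
  set x := c.trans e with hxdef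
  have hx : x ∈ IsManifold.maximalAtlas (𝓡 n) ∞ M := by
    refine x.mem_maximalAtlas_of_contMDiffOn ?_ ?_
    · rw [hxdef, OpenPartialHomeomorph.trans_source, OpenPartialHomeomorph.coe_trans]
      exact hesm.contMDiffOn.comp' (contMDiffOn_of_mem_maximalAtlas hc)
    · rw [hxdef, OpenPartialHomeomorph.trans_target, OpenPartialHomeomorph.coe_trans_symm]
      exact (contMDiffOn_symm_of_mem_maximalAtlas hc).comp' he'.contMDiffOn
  refine ⟨x, isAffineChart_of_connection_eq_zero hx ?_, by simpa [hxdef] using ⟨hp, hpe⟩⟩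
  intro q hq w
  have hqce : q ∈ c.source ∧ c q ∈ e.source := by simpa [hxdef] using hq
  obtain ⟨hqc, hqe⟩ := hqce
  have hψ : x ∘ c.symm =ᶠ[𝓝 (c q)] X := by
    filter_upwards [c.open_target.mem_nhds (c.map_source hqc)] with y hy
    simp [hxdef, c.right_inv hy, heX]
  have hψ1 : fderiv ℝ (x ∘ c.symm) (c q) = fderiv ℝ X (c q) := hψ.fderiv_eq
  have hψ2 : fderiv ℝ (fderiv ℝ (x ∘ c.symm)) (c q) = fderiv ℝ (fderiv ℝ X) (c q) :=
    hψ.fderiv.fderiv_eq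
  -- Write the constant `w` as `DX(u)` at `c q`. In the change of chart formula `D²X(a, u) = DX(Γ(a,
  -- u))` turns the second derivative term into the left side, so the derivative of the new
  -- coordinate field must vanish.
  obtain ⟨u, rfl⟩ := hesurj _ hqe w
  ext1 v
  have h := connection_chart_change D hc hx hqc hq u v
  have h2 := coordField_chart_change hc hx hqc hq
    (christoffel D c (c q) (chartDeriv c q v) u)
  rw [hψ1] at h h2
  rw [hψ2, hX2 _ (her hqe), h2, ← connection_coordField_eq_christoffel D hc hqc] at h
  rw [zero_apply]
  exact right_eq_add.1 h

end AffineChart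

/-! ### The derivative of `f_*` in the preferred charts. -/

section TangentMap

variable {n d : ℕ} {M M' : Type*}
  [TopologicalSpace M] [ChartedSpace (EuclideanSpace ℝ (Fin n)) M] [IsManifold (𝓡 n) ∞ M]
  [TopologicalSpace M'] [ChartedSpace (EuclideanSpace ℝ (Fin d)) M'] [IsManifold (𝓡 d) ∞ M']
  {f : M → M'}

/-- The expression of `f` in the charts `c` and `c'`. -/
def inCharts (f : M → M') (c : OpenPartialHomeomorph M (EuclideanSpace ℝ (Fin n)))
    (c' : OpenPartialHomeomorph M' (EuclideanSpace ℝ (Fin d))) :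
    EuclideanSpace ℝ (Fin n) → EuclideanSpace ℝ (Fin d) :=
  c' ∘ f ∘ c.symm

theorem contDiffAt_inCharts (hf : ContMDiff (𝓡 n) (𝓡 d) ∞ f)
    {c : OpenPartialHomeomorph M (EuclideanSpace ℝ (Fin n))}
    (hc : c ∈ IsManifold.maximalAtlas (𝓡 n) ∞ M)
    {c' : OpenPartialHomeomorph M' (EuclideanSpace ℝ (Fin d))}
    (hc' : c' ∈ IsManifold.maximalAtlas (𝓡 d) ∞ M') {y : EuclideanSpace ℝ (Fin n)}
    (hy : y ∈ c.target) (hfy : f (c.symm y) ∈ c'.source) :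
    ContDiffAt ℝ ∞ (inCharts f c c') y := by
  rw [← contMDiffAt_iff_contDiffAt]
  exact (contMDiffAt_of_mem_maximalAtlas hc' hfy).comp y
    (hf.contMDiffAt.comp y (contMDiffAt_symm_of_mem_maximalAtlas hc hy))

theorem chartDeriv_mfderiv (hf : ContMDiff (𝓡 n) (𝓡 d) ∞ f)
    {c : OpenPartialHomeomorph M (EuclideanSpace ℝ (Fin n))}
    (hc : c ∈ IsManifold.maximalAtlas (𝓡 n) ∞ M)
    {c' : OpenPartialHomeomorph M' (EuclideanSpace ℝ (Fin d))}
    (hc' : c' ∈ IsManifold.maximalAtlas (𝓡 d) ∞ M') {p : M}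
    (hp : p ∈ c.source) (hfp : f p ∈ c'.source) (v : TangentSpace (𝓡 n) p) :
    chartDeriv c' (f p) (mfderiv (𝓡 n) (𝓡 d) f p v)
      = fderiv ℝ (inCharts f c c') (c p) (chartDeriv c p v) := by
  have h1 : HasMFDerivAt (𝓡 n) (𝓡 d) (inCharts f c c') (c p)
      (fderiv ℝ (inCharts f c c') (c p)) :=
    ((contDiffAt_inCharts hf hc hc' (c.map_source hp) (by rwa [c.left_inv hp])).differentiableAt
      (by simp)).hasFDerivAt.hasMFDerivAt
  have h2 := h1.comp p ((mdifferentiable_of_mem_maximalAtlas hc).mdifferentiableAt hp).hasMFDerivAt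
  have h3 := ((mdifferentiable_of_mem_maximalAtlas hc').mdifferentiableAt hfp).hasMFDerivAt.comp p
    (hf.mdifferentiableAt (by simp) (x := p)).hasMFDerivAt
  have h4 : c' ∘ f =ᶠ[𝓝 p] inCharts f c c' ∘ c := by
    filter_upwards [c.open_source.mem_nhds hp] with q hq
    simp [inCharts, c.left_inv hq]
  have h5 := hasMFDerivAt_unique h3 (h2.congr_of_eventuallyEq h4)
  exact congrArg (fun L : TangentSpace (𝓡 n) p →L[ℝ] EuclideanSpace ℝ (Fin d) ↦ L v) h5

/-- The tangent space at `p` is the model space read through the preferred chart at `p`, so that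
chart has identity derivative there. -/
theorem chartDeriv_chartAt (p : M) (v : TangentSpace (𝓡 n) p) :
    chartDeriv (chartAt (EuclideanSpace ℝ (Fin n)) p) p v = v := by
  rw [chartDeriv, mfderiv_chartAt_eq_tangentCoordChange (mem_chart_source _ p)]
  exact tangentCoordChange_self (I := 𝓡 n) (by simp)

/-- The charts of the tangent bundle are tangent maps of charts of the base, so functoriality of
`tangentMap` applies. -/
theorem writtenInExtChartAt_tangentMap (hf : ContMDiff (𝓡 n) (𝓡 d) ∞ f)
    (u : TangentBundle (𝓡 n) M)
    {y : EuclideanSpace ℝ (Fin n) × EuclideanSpace ℝ (Fin n)}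
    (hy : y.1 ∈ (chartAt (EuclideanSpace ℝ (Fin n)) u.proj).target)
    (hfy : f ((chartAt (EuclideanSpace ℝ (Fin n)) u.proj).symm y.1)
      ∈ (chartAt (EuclideanSpace ℝ (Fin d)) (f u.proj)).source) :
    writtenInExtChartAt (𝓡 n).tangent (𝓡 d).tangent u (tangentMap (𝓡 n) (𝓡 d) f) y
      = (inCharts f (chartAt (EuclideanSpace ℝ (Fin n)) u.proj)
            (chartAt (EuclideanSpace ℝ (Fin d)) (f u.proj)) y.1,
          fderiv ℝ (inCharts f (chartAt (EuclideanSpace ℝ (Fin n)) u.proj)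
            (chartAt (EuclideanSpace ℝ (Fin d)) (f u.proj))) y.1 y.2) := by
  set c := chartAt (EuclideanSpace ℝ (Fin n)) u.proj
  set c' := chartAt (EuclideanSpace ℝ (Fin d)) (f u.proj)
  let w : TangentBundle (𝓡 n) (EuclideanSpace ℝ (Fin n)) := ⟨y.1, y.2⟩
  have h1 : (extChartAt (𝓡 n).tangent u).symm y = tangentMap (𝓡 n) (𝓡 n) c.symm w := by
    rw [tangentMap_chart_symm (p := u) (q := w) hy]
    rfl
  have hsrc : (tangentMap (𝓡 n) (𝓡 d) f (tangentMap (𝓡 n) (𝓡 n) c.symm w)).1 ∈ c'.source := hfy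
  have h2 := tangentMap_chart (I := 𝓡 d) (p := tangentMap (𝓡 n) (𝓡 d) f u) hsrc
  have hc : c ∈ IsManifold.maximalAtlas (𝓡 n) ∞ M := IsManifold.chart_mem_maximalAtlas _
  have hc' : c' ∈ IsManifold.maximalAtlas (𝓡 d) ∞ M' := IsManifold.chart_mem_maximalAtlas _
  have h3 : tangentMap (𝓡 d) (𝓡 d) c' (tangentMap (𝓡 n) (𝓡 d) f
      (tangentMap (𝓡 n) (𝓡 n) c.symm w)) = tangentMap (𝓡 n) (𝓡 d) (inCharts f c c') w := by
    have hs := (mdifferentiable_of_mem_maximalAtlas hc).mdifferentiableAt_symm hy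
    rw [inCharts, tangentMap_comp_at w
      ((mdifferentiable_of_mem_maximalAtlas hc').mdifferentiableAt hfy)
      ((hf.mdifferentiableAt (by simp)).comp _ hs),
      tangentMap_comp_at w (hf.mdifferentiableAt (by simp)) hs]
  have h4 : writtenInExtChartAt (𝓡 n).tangent (𝓡 d).tangent u (tangentMap (𝓡 n) (𝓡 d) f) y
      = TotalSpace.toProd _ _ (tangentMap (𝓡 d) (𝓡 d) c' (tangentMap (𝓡 n) (𝓡 d) f
        (tangentMap (𝓡 n) (𝓡 n) c.symm w))) := by
    have h5 := congrArg (TotalSpace.toProd _ _) h2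
    rw [Equiv.apply_symm_apply] at h5
    refine Eq.trans ?_ h5.symm
    rw [← h1]
    rfl
  rw [h4, h3]
  refine Prod.ext rfl ?_
  change mfderiv (𝓡 n) (𝓡 d) (inCharts f c c') y.1 y.2 = _
  rw [mfderiv_eq_fderiv]
  rfl

theorem extChartAt_tangent_self (u : TangentBundle (𝓡 n) M) :
    extChartAt (𝓡 n).tangent u u
      = (chartAt (EuclideanSpace ℝ (Fin n)) u.proj u.proj, u.2) := by
  have h := tangentMap_chart (I := 𝓡 n) (p := u) (q := u) (mem_chart_source _ u.proj)
  have h1 := congrArg (TotalSpace.toProd _ _) h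
  rw [Equiv.apply_symm_apply] at h1
  refine Eq.trans (b := TotalSpace.toProd _ _
    (tangentMap (𝓡 n) (𝓡 n) (chartAt (EuclideanSpace ℝ (Fin n)) u.proj) u)) ?_ ?_
  · rw [h1]
    rfl
  · exact Prod.ext rfl (chartDeriv_chartAt u.proj u.2)

/-- The derivative of `f_*` in the preferred charts. -/
theorem mfderiv_tangentMap_apply (hf : ContMDiff (𝓡 n) (𝓡 d) ∞ f) (u : TangentBundle (𝓡 n) M)
    (A : EuclideanSpace ℝ (Fin n) × EuclideanSpace ℝ (Fin n)) :
    (mfderiv (𝓡 n).tangent (𝓡 d).tangent (tangentMap (𝓡 n) (𝓡 d) f) u A :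
        EuclideanSpace ℝ (Fin d) × EuclideanSpace ℝ (Fin d))
      = (fderiv ℝ (inCharts f (chartAt (EuclideanSpace ℝ (Fin n)) u.proj)
            (chartAt (EuclideanSpace ℝ (Fin d)) (f u.proj)))
            (chartAt (EuclideanSpace ℝ (Fin n)) u.proj u.proj) A.1,
          fderiv ℝ (fderiv ℝ (inCharts f (chartAt (EuclideanSpace ℝ (Fin n)) u.proj)
            (chartAt (EuclideanSpace ℝ (Fin d)) (f u.proj))))
            (chartAt (EuclideanSpace ℝ (Fin n)) u.proj u.proj) A.1 u.2
          + fderiv ℝ (inCharts f (chartAt (EuclideanSpace ℝ (Fin n)) u.proj)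
            (chartAt (EuclideanSpace ℝ (Fin d)) (f u.proj)))
            (chartAt (EuclideanSpace ℝ (Fin n)) u.proj u.proj) A.2) := by
  set c := chartAt (EuclideanSpace ℝ (Fin n)) u.proj with hcdef
  set c' := chartAt (EuclideanSpace ℝ (Fin d)) (f u.proj) with hc'def
  have hc : c ∈ IsManifold.maximalAtlas (𝓡 n) ∞ M := IsManifold.chart_mem_maximalAtlas _
  have hc' : c' ∈ IsManifold.maximalAtlas (𝓡 d) ∞ M' := IsManifold.chart_mem_maximalAtlas _
  have hp : u.proj ∈ c.source := mem_chart_source _ _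
  have hfp : f u.proj ∈ c'.source := mem_chart_source _ _
  set φ := inCharts f c c' with hφ
  have hφs : ContDiffAt ℝ ∞ φ (c u.proj) :=
    contDiffAt_inCharts hf hc hc' (c.map_source hp) (by rwa [c.left_inv hp])
  have hφ' : HasFDerivAt (fderiv ℝ φ) (fderiv ℝ (fderiv ℝ φ) (c u.proj)) (c u.proj) :=
    ((hφs.fderiv_right (m := ∞) (by simp)).differentiableAt (by simp)).hasFDerivAt
  let w : EuclideanSpace ℝ (Fin n) := u.2
  have hfst : HasFDerivAt (fun y : EuclideanSpace ℝ (Fin n) × EuclideanSpace ℝ (Fin n) ↦ y.1)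
      (ContinuousLinearMap.fst ℝ _ _) (c u.proj, w) := hasFDerivAt_fst
  have h1 := HasFDerivAt.comp (c u.proj, w) (hφs.differentiableAt (by simp)).hasFDerivAt hfst
  have h2 := (HasFDerivAt.comp (c u.proj, w) hφ' hfst).clm_apply
    (hasFDerivAt_snd (𝕜 := ℝ) (p := (c u.proj, w)))
  have h3 := h1.prodMk h2
  have hdom : ∀ᶠ z in 𝓝 (c u.proj), z ∈ c.target ∧ f (c.symm z) ∈ c'.source := by
    refine (c.open_target.eventually_mem (c.map_source hp)).and ?_
    have hcont : ContinuousAt (fun z ↦ f (c.symm z)) (c u.proj) :=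
      hf.continuous.continuousAt.comp (c.continuousAt_symm (c.map_source hp))
    exact hcont.eventually_mem (c'.open_source.mem_nhds (by rwa [c.left_inv hp]))
  have hwr : writtenInExtChartAt (𝓡 n).tangent (𝓡 d).tangent u (tangentMap (𝓡 n) (𝓡 d) f)
      =ᶠ[𝓝 (c u.proj, w)] fun y ↦ (φ y.1, fderiv ℝ φ y.1 y.2) := by
    filter_upwards [continuousAt_fst.eventually hdom] with y hy
    exact writtenInExtChartAt_tangentMap hf u hy.1 hy.2
  have hT : ContMDiff (𝓡 n).tangent (𝓡 d).tangent ∞ (tangentMap (𝓡 n) (𝓡 d) f) :=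
    hf.contMDiff_tangentMap (by simp)
  have hm := hT.mdifferentiableAt (by simp) (x := u)
  rw [hm.mfderiv]
  have hr : range ((𝓡 n).tangent) = univ := by
    rw [ModelWithCorners.range_eq_univ]
  rw [hr, fderivWithin_univ, show extChartAt (𝓡 n).tangent u u = (c u.proj, w) from
    extChartAt_tangent_self u]
  have h4 := (h3.congr_of_eventuallyEq hwr).fderiv
  refine (congrArg (fun L : (EuclideanSpace ℝ (Fin n) × EuclideanSpace ℝ (Fin n)) →L[ℝ]
    (EuclideanSpace ℝ (Fin d) × EuclideanSpace ℝ (Fin d)) ↦ L A) h4).trans ?_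
  refine Prod.ext rfl ?_
  change fderiv ℝ φ (c u.proj) A.2 + fderiv ℝ (fderiv ℝ φ) (c u.proj) A.1 w = _
  exact add_comm _ _

end TangentMap

/-! ### The Hessian of a map. -/

theorem fderiv_fderiv_comp_apply {E F G : Type*} [NormedAddCommGroup E] [NormedSpace ℝ E]
    [NormedAddCommGroup F] [NormedSpace ℝ F] [NormedAddCommGroup G] [NormedSpace ℝ G]
    {g : F → G} {f : E → F} {y : E} (hg : ContDiffAt ℝ ∞ g (f y)) (hf : ContDiffAt ℝ ∞ f y)
    (a u : E) :
    fderiv ℝ (fderiv ℝ (g ∘ f)) y a u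
      = fderiv ℝ (fderiv ℝ g) (f y) (fderiv ℝ f y a) (fderiv ℝ f y u)
        + fderiv ℝ g (f y) (fderiv ℝ (fderiv ℝ f) y a u) := by
  have hle : (1 : ℕ∞ω) ≤ ∞ := by simp
  have hev : fderiv ℝ (g ∘ f) =ᶠ[𝓝 y] fun z ↦ (fderiv ℝ g (f z)).comp (fderiv ℝ f z) := by
    have h1 := (hg.of_le hle).eventually (by simp)
    have h2 := (hf.of_le hle).eventually (by simp)
    filter_upwards [hf.continuousAt.eventually h1, h2] with z hz1 hz2
    exact fderiv_comp z (hz1.differentiableAt (by simp)) (hz2.differentiableAt (by simp))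
  have hg2 : HasFDerivAt (fderiv ℝ g) (fderiv ℝ (fderiv ℝ g) (f y)) (f y) :=
    ((hg.fderiv_right (m := ∞) (by simp)).differentiableAt (by simp)).hasFDerivAt
  have hf2 : HasFDerivAt (fderiv ℝ f) (fderiv ℝ (fderiv ℝ f) y) y :=
    ((hf.fderiv_right (m := ∞) (by simp)).differentiableAt (by simp)).hasFDerivAt
  have hf1 : HasFDerivAt f (fderiv ℝ f y) y := (hf.differentiableAt (by simp)).hasFDerivAt
  have h := (HasFDerivAt.clm_comp (HasFDerivAt.comp y hg2 hf1) hf2).congr_of_eventuallyEq hev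
  rw [h.fderiv]
  simp [add_comm]

section Hessian

variable {n d : ℕ} {M M' : Type*}
  [TopologicalSpace M] [ChartedSpace (EuclideanSpace ℝ (Fin n)) M] [IsManifold (𝓡 n) ∞ M]
  [TopologicalSpace M'] [ChartedSpace (EuclideanSpace ℝ (Fin d)) M'] [IsManifold (𝓡 d) ∞ M']
  (D : Connection n M) (D' : Connection d M') {f : M → M'}

/-- The second derivative of `f` in the preferred charts at `p` and `f p`. -/
def secondDeriv (f : M → M') (p : M) (u : TangentSpace (𝓡 n) p) :
    TangentSpace (𝓡 n) p →L[ℝ] TangentSpace (𝓡 d) (f p) :=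
  ((fderiv ℝ (fderiv ℝ (inCharts f (chartAt (EuclideanSpace ℝ (Fin n)) p)
    (chartAt (EuclideanSpace ℝ (Fin d)) (f p)))) (chartAt (EuclideanSpace ℝ (Fin n)) p p)).flip u :
    EuclideanSpace ℝ (Fin n) →L[ℝ] EuclideanSpace ℝ (Fin d))

/-- The Hessian `(∇ df)(v, u)` of a map between manifolds with connections, as a linear map in `v`,
computed in the preferred charts. -/
def hessian (f : M → M') (p : M) (u : TangentSpace (𝓡 n) p) :
    TangentSpace (𝓡 n) p →L[ℝ] TangentSpace (𝓡 d) (f p) :=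
  secondDeriv f p u
    + (D' (coordField (chartAt (EuclideanSpace ℝ (Fin d)) (f p)) (mfderiv (𝓡 n) (𝓡 d) f p u))
        (f p)).comp (mfderiv (𝓡 n) (𝓡 d) f p)
    - (mfderiv (𝓡 n) (𝓡 d) f p).comp
        (D (coordField (chartAt (EuclideanSpace ℝ (Fin n)) p) u) p)

theorem mfderiv_eq_fderiv_inCharts (hf : ContMDiff (𝓡 n) (𝓡 d) ∞ f) (p : M)
    (v : TangentSpace (𝓡 n) p) :
    mfderiv (𝓡 n) (𝓡 d) f p v = fderiv ℝ (inCharts f (chartAt (EuclideanSpace ℝ (Fin n)) p)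
      (chartAt (EuclideanSpace ℝ (Fin d)) (f p))) (chartAt (EuclideanSpace ℝ (Fin n)) p p) v := by
  have h := chartDeriv_mfderiv hf (IsManifold.chart_mem_maximalAtlas (I := 𝓡 n) (n := ∞) p)
    (IsManifold.chart_mem_maximalAtlas (I := 𝓡 d) (n := ∞) (f p)) (mem_chart_source _ p)
    (mem_chart_source _ (f p)) v
  rwa [chartDeriv_chartAt, chartDeriv_chartAt] at h

theorem projDeriv_mfderiv_tangentMap (hf : ContMDiff (𝓡 n) (𝓡 d) ∞ f)
    (u : TangentBundle (𝓡 n) M) (A : TangentSpace (𝓡 n).tangent u) :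
    projDeriv (tangentMap (𝓡 n) (𝓡 d) f u)
        (mfderiv (𝓡 n).tangent (𝓡 d).tangent (tangentMap (𝓡 n) (𝓡 d) f) u A)
      = mfderiv (𝓡 n) (𝓡 d) f u.proj (projDeriv u A) := by
  rw [projDeriv_apply, mfderiv_eq_fderiv_inCharts hf, projDeriv_apply]
  exact congrArg Prod.fst (mfderiv_tangentMap_apply hf u A)

/-- The vertical coordinate of the image is `D²φ(a, u) + Dφ(b)`, with `φ` the local expression of
`f` and `(a, b)` the coordinates of `A`. The connector of `D'` adds its Christoffel term, while `df`
applied to the connector of `D` contributes that of `D`; the discrepancy is the Hessian. -/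
theorem connector_mfderiv_tangentMap (hf : ContMDiff (𝓡 n) (𝓡 d) ∞ f)
    (u : TangentBundle (𝓡 n) M) (A : TangentSpace (𝓡 n).tangent u) :
    connector D' (tangentMap (𝓡 n) (𝓡 d) f u)
        (mfderiv (𝓡 n).tangent (𝓡 d).tangent (tangentMap (𝓡 n) (𝓡 d) f) u A)
      = mfderiv (𝓡 n) (𝓡 d) f u.proj (connector D u A)
        + hessian D D' f u.proj u.2 (projDeriv u A) := by
  let V : TangentSpace (𝓡 d) (f u.proj) := vertCoord (tangentMap (𝓡 n) (𝓡 d) f u)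
    (mfderiv (𝓡 n).tangent (𝓡 d).tangent (tangentMap (𝓡 n) (𝓡 d) f) u A)
  have hv : V = secondDeriv f u.proj u.2 (projDeriv u A)
      + mfderiv (𝓡 n) (𝓡 d) f u.proj (vertCoord u A) := by
    rw [projDeriv_apply, mfderiv_eq_fderiv_inCharts hf]
    exact congrArg Prod.snd (mfderiv_tangentMap_apply hf u A)
  have h1 : connector D' (tangentMap (𝓡 n) (𝓡 d) f u)
        (mfderiv (𝓡 n).tangent (𝓡 d).tangent (tangentMap (𝓡 n) (𝓡 d) f) u A) = V
      + D' (coordField (chartAt (EuclideanSpace ℝ (Fin d)) (f u.proj))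
        (mfderiv (𝓡 n) (𝓡 d) f u.proj u.2)) (f u.proj)
        (projDeriv (tangentMap (𝓡 n) (𝓡 d) f u)
        (mfderiv (𝓡 n).tangent (𝓡 d).tangent (tangentMap (𝓡 n) (𝓡 d) f) u A)) := rfl
  have h2 : connector D u A = vertCoord u A
    + D (coordField (chartAt (EuclideanSpace ℝ (Fin n)) u.proj) u.2) u.proj (projDeriv u A) := rfl
  have h3 : hessian D D' f u.proj u.2 (projDeriv u A) = secondDeriv f u.proj u.2 (projDeriv u A)
    + D' (coordField (chartAt (EuclideanSpace ℝ (Fin d)) (f u.proj))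
        (mfderiv (𝓡 n) (𝓡 d) f u.proj u.2)) (f u.proj)
        (mfderiv (𝓡 n) (𝓡 d) f u.proj (projDeriv u A))
    - mfderiv (𝓡 n) (𝓡 d) f u.proj
      (D (coordField (chartAt (EuclideanSpace ℝ (Fin n)) u.proj) u.2) u.proj (projDeriv u A)) := rfl
  rw [h1, h2, h3, hv, projDeriv_mfderiv_tangentMap hf, map_add]
  abel

variable {D D'}

/-- In affine charts the Hessian is the ordinary second derivative. -/
theorem chartDeriv_hessian (hf : ContMDiff (𝓡 n) (𝓡 d) ∞ f)
    {x : OpenPartialHomeomorph M (EuclideanSpace ℝ (Fin n))}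
    {x' : OpenPartialHomeomorph M' (EuclideanSpace ℝ (Fin d))}
    (hx : IsAffineChart D x) (hx' : IsAffineChart D' x') {p : M} (hp : p ∈ x.source)
    (hfp : f p ∈ x'.source) (u v : TangentSpace (𝓡 n) p) :
    chartDeriv x' (f p) (hessian D D' f p u v)
      = fderiv ℝ (fderiv ℝ (inCharts f x x')) (x p) (chartDeriv x p v) (chartDeriv x p u) := by
  set c := chartAt (EuclideanSpace ℝ (Fin n)) p with hcdef
  set c' := chartAt (EuclideanSpace ℝ (Fin d)) (f p) with hc'def
  have hc : c ∈ IsManifold.maximalAtlas (𝓡 n) ∞ M := IsManifold.chart_mem_maximalAtlas _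
  have hc' : c' ∈ IsManifold.maximalAtlas (𝓡 d) ∞ M' := IsManifold.chart_mem_maximalAtlas _
  have hpc : p ∈ c.source := mem_chart_source _ _
  have hfpc : f p ∈ c'.source := mem_chart_source _ _
  have hxm := hx.mem_maximalAtlas
  have hxm' := hx'.mem_maximalAtlas
  set φ := inCharts f c c' with hφ
  have hφp : φ (c p) = c' (f p) := by simp [hφ, inCharts, c.left_inv hpc]
  have hψp : (x ∘ c.symm) (c p) = x p := by simp [c.left_inv hpc]
  have hφs : ContDiffAt ℝ ∞ φ (c p) :=
    contDiffAt_inCharts hf hc hc' (c.map_source hpc) (by rwa [c.left_inv hpc])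
  have hθs : ContDiffAt ℝ ∞ (inCharts f x x') (x p) :=
    contDiffAt_inCharts hf hxm hxm' (x.map_source hp) (by rwa [x.left_inv hp])
  have hψs := contDiffAt_chart_change hc hxm hpc hp
  have hψs' := contDiffAt_chart_change hc' hxm' hfpc hfp
  have hev : (x' ∘ c'.symm) ∘ φ =ᶠ[𝓝 (c p)] inCharts f x x' ∘ (x ∘ c.symm) := by
    have h1 : ∀ᶠ z in 𝓝 (c p), c.symm z ∈ x.source ∩ f ⁻¹' c'.source :=
      (c.continuousAt_symm (c.map_source hpc)).eventually_mem
        ((x.open_source.inter (c'.open_source.preimage hf.continuous)).mem_nhds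
          (by rw [c.left_inv hpc]; exact ⟨hp, hfpc⟩))
    filter_upwards [h1] with z hz
    simp [hφ, inCharts, x.left_inv hz.1, c'.left_inv hz.2]
  let a : EuclideanSpace ℝ (Fin n) := v
  let b : EuclideanSpace ℝ (Fin n) := u
  have hca : chartDeriv c p v = a := chartDeriv_chartAt p v
  have hcb : chartDeriv c p u = b := chartDeriv_chartAt p u
  -- The map `x' ∘ f ∘ c.symm` factors through `c'` and through `x`. The second order chain rule for
  -- each factorization gives correction terms, which by `e2` and `e3` are the connection terms of
  -- the Hessian.
  have key : fderiv ℝ (fderiv ℝ ((x' ∘ c'.symm) ∘ φ)) (c p) a b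
      = fderiv ℝ (fderiv ℝ (inCharts f x x' ∘ (x ∘ c.symm))) (c p) a b := by
    rw [hev.fderiv.fderiv_eq]
  rw [fderiv_fderiv_comp_apply (by rwa [hφp]) hφs, fderiv_fderiv_comp_apply (by rwa [hψp]) hψs,
    hφp, hψp] at key
  have hφ1 : ∀ w : TangentSpace (𝓡 n) p, chartDeriv c' (f p) (mfderiv (𝓡 n) (𝓡 d) f p w)
      = fderiv ℝ φ (c p) (chartDeriv c p w) := chartDeriv_mfderiv hf hc hc' hpc hfpc
  have e1 : chartDeriv x' (f p) (secondDeriv f p u v)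
      = fderiv ℝ (x' ∘ c'.symm) (c' (f p)) (fderiv ℝ (fderiv ℝ φ) (c p) a b) := by
    rw [chartDeriv_eq hc' hxm' hfpc hfp]
    exact congrArg _ (chartDeriv_chartAt (f p) _)
  let b' : EuclideanSpace ℝ (Fin d) := mfderiv (𝓡 n) (𝓡 d) f p u
  have hb' : b' = fderiv ℝ φ (c p) b := mfderiv_eq_fderiv_inCharts hf p u
  have e2 : chartDeriv x' (f p) (D' (coordField c' b') (f p) (mfderiv (𝓡 n) (𝓡 d) f p v))
      = fderiv ℝ (fderiv ℝ (x' ∘ c'.symm)) (c' (f p)) (fderiv ℝ φ (c p) a)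
        (fderiv ℝ φ (c p) b) := by
    rw [connection_chart_change D' hc' hxm' hfpc hfp,
      hx'.connection_coordField_eq_zero hfp, zero_apply, zero_add,
      chartDeriv_coordField hxm' hfp, hφ1, hca, hb']
  have e3 : chartDeriv x' (f p) (mfderiv (𝓡 n) (𝓡 d) f p (D (coordField c b) p v))
      = fderiv ℝ (inCharts f x x') (x p) (fderiv ℝ (fderiv ℝ (x ∘ c.symm)) (c p) a b) := by
    rw [chartDeriv_mfderiv hf hxm hxm' hp hfp, connection_chart_change D hc hxm hpc hp,
      hx.connection_coordField_eq_zero hp, zero_apply, zero_add,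
      chartDeriv_coordField hxm hp, hca]
  have e4 : hessian D D' f p u v = secondDeriv f p u v
    + D' (coordField c' b') (f p) (mfderiv (𝓡 n) (𝓡 d) f p v)
    - mfderiv (𝓡 n) (𝓡 d) f p (D (coordField c b) p v) := rfl
  rw [e4, map_sub, map_add, e1, e2, e3, chartDeriv_eq hc hxm hpc hp, chartDeriv_eq hc hxm hpc hp,
    hca, hcb, add_comm, key, add_sub_cancel_right]

end Hessian

/-! ### Holomorphic, isometric and immersive derivatives. -/

section Main

variable {n d : ℕ} {M M' : Type*}
  [TopologicalSpace M] [ChartedSpace (EuclideanSpace ℝ (Fin n)) M] [IsManifold (𝓡 n) ∞ M]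
  [TopologicalSpace M'] [ChartedSpace (EuclideanSpace ℝ (Fin d)) M'] [IsManifold (𝓡 d) ∞ M']
  {D : Connection n M} {D' : Connection d M'} {f : M → M'}

theorem splitEquiv_complexStructure (u : TangentBundle (𝓡 n) M)
    (A : TangentSpace (𝓡 n).tangent u) :
    splitEquiv D u (complexStructure D u A) = (-(splitEquiv D u A).2, (splitEquiv D u A).1) :=
  (splitEquiv D u).apply_symm_apply _

theorem splitEquiv_mfderiv_tangentMap (hf : ContMDiff (𝓡 n) (𝓡 d) ∞ f)
    (u : TangentBundle (𝓡 n) M) (A : TangentSpace (𝓡 n).tangent u) :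
    splitEquiv D' (tangentMap (𝓡 n) (𝓡 d) f u)
        (mfderiv (𝓡 n).tangent (𝓡 d).tangent (tangentMap (𝓡 n) (𝓡 d) f) u A)
      = (mfderiv (𝓡 n) (𝓡 d) f u.proj (splitEquiv D u A).1,
          mfderiv (𝓡 n) (𝓡 d) f u.proj (splitEquiv D u A).2
            + hessian D D' f u.proj u.2 (splitEquiv D u A).1) :=
  Prod.ext (projDeriv_mfderiv_tangentMap hf u A) (connector_mfderiv_tangentMap D D' hf u A)

/-- `f_*` is holomorphic if and only if the Hessian of `f` vanishes. -/
theorem isHolomorphic_tangentMap_iff_hessian (hf : ContMDiff (𝓡 n) (𝓡 d) ∞ f) :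
    IsHolomorphic (𝓡 n).tangent (𝓡 d).tangent (complexStructure D) (complexStructure D')
        (tangentMap (𝓡 n) (𝓡 d) f)
      ↔ ∀ (p : M) (u : TangentSpace (𝓡 n) p), hessian D D' f p u = 0 := by
  have hT : ContMDiff (𝓡 n).tangent (𝓡 d).tangent ∞ (tangentMap (𝓡 n) (𝓡 d) f) :=
    hf.contMDiff_tangentMap (by simp)
  have key : ∀ (u : TangentBundle (𝓡 n) M) (A : TangentSpace (𝓡 n).tangent u),
      mfderiv (𝓡 n).tangent (𝓡 d).tangent (tangentMap (𝓡 n) (𝓡 d) f) u (complexStructure D u A)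
        = complexStructure D' (tangentMap (𝓡 n) (𝓡 d) f u)
          (mfderiv (𝓡 n).tangent (𝓡 d).tangent (tangentMap (𝓡 n) (𝓡 d) f) u A)
      ↔ hessian D D' f u.proj u.2 (splitEquiv D u A).1 = 0
        ∧ hessian D D' f u.proj u.2 (splitEquiv D u A).2 = 0 := by
    intro u A
    set v := (splitEquiv D u A).1 with hv
    set w := (splitEquiv D u A).2 with hw
    have h1 : splitEquiv D' (tangentMap (𝓡 n) (𝓡 d) f u)
        (mfderiv (𝓡 n).tangent (𝓡 d).tangent (tangentMap (𝓡 n) (𝓡 d) f) u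
          (complexStructure D u A))
        = (mfderiv (𝓡 n) (𝓡 d) f u.proj (-w), mfderiv (𝓡 n) (𝓡 d) f u.proj v
          + hessian D D' f u.proj u.2 (-w)) := by
      rw [splitEquiv_mfderiv_tangentMap (D := D) hf, splitEquiv_complexStructure]
    have h2 : splitEquiv D' (tangentMap (𝓡 n) (𝓡 d) f u)
        (complexStructure D' (tangentMap (𝓡 n) (𝓡 d) f u)
          (mfderiv (𝓡 n).tangent (𝓡 d).tangent (tangentMap (𝓡 n) (𝓡 d) f) u A))
        = (-(mfderiv (𝓡 n) (𝓡 d) f u.proj w + hessian D D' f u.proj u.2 v),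
          mfderiv (𝓡 n) (𝓡 d) f u.proj v) := by
      rw [splitEquiv_complexStructure, splitEquiv_mfderiv_tangentMap (D := D) hf]
      rfl
    -- In the splitting of the target the `df` terms agree on both sides, leaving one Hessian value
    -- in each component.
    rw [← (splitEquiv D' (tangentMap (𝓡 n) (𝓡 d) f u)).injective.eq_iff, h1, h2,
      map_neg, map_neg]
    refine Prod.ext_iff.trans (and_congr ?_ ?_)
    · exact neg_inj.trans left_eq_add
    · exact add_eq_left.trans neg_eq_zero
  constructor
  · intro h p u
    ext1 v
    let U : TangentBundle (𝓡 n) M := ⟨p, u⟩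
    have h1 := ((key U ((splitEquiv D U).symm (v, 0))).1 (h.2 _ _)).1
    rwa [LinearEquiv.apply_symm_apply] at h1
  · intro h
    refine ⟨hT, fun u A ↦ (key u A).2 ?_⟩
    rw [h]
    exact ⟨rfl, rfl⟩

theorem hessian_eq_zero_of_isAffine (hf : ContMDiff (𝓡 n) (𝓡 d) ∞ f) (h : IsAffine D D' f)
    (p : M) (u : TangentSpace (𝓡 n) p) : hessian D D' f p u = 0 := by
  obtain ⟨x, x', a, hx, hx', hp, hmaps, ha⟩ := h p
  ext1 v
  have h1 := chartDeriv_hessian hf hx hx' hp (hmaps hp) u v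
  have hev : inCharts f x x' =ᶠ[𝓝 (x p)] a := by
    filter_upwards [x.open_target.mem_nhds (x.map_source hp)] with y hy
    exact ha y hy
  have ha1 : fderiv ℝ a = fun _ ↦ LinearMap.toContinuousLinearMap a.linear := by
    funext y
    have h2 : (a : EuclideanSpace ℝ (Fin n) → EuclideanSpace ℝ (Fin d))
        = fun z ↦ LinearMap.toContinuousLinearMap a.linear z + a 0 := by
      funext z
      simpa using congrFun a.decomp z
    rw [h2, fderiv_add_const]
    exact ContinuousLinearMap.fderiv _
  rw [hev.fderiv.fderiv_eq, ha1, fderiv_fun_const] at h1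
  rw [← coordField_chartDeriv hx'.mem_maximalAtlas (hmaps hp) (hessian D D' f p u v), h1]
  exact coordField_zero

/-- The ball is convex, so the derivative is a constant `L`, and then `θ - L` is constant. -/
theorem exists_affineMap_eqOn_ball {E F : Type*} [NormedAddCommGroup E] [NormedSpace ℝ E]
    [NormedAddCommGroup F] [NormedSpace ℝ F] {θ : E → F} {x₀ : E} {r : ℝ}
    (hθ : ∀ y ∈ Metric.ball x₀ r, ContDiffAt ℝ ∞ θ y)
    (h2 : ∀ y ∈ Metric.ball x₀ r, fderiv ℝ (fderiv ℝ θ) y = 0) :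
    ∃ a : E →ᵃ[ℝ] F, ∀ y ∈ Metric.ball x₀ r, θ y = a y := by
  rcases le_or_gt r 0 with hr | hr
  · exact ⟨0, by simp [Metric.ball_eq_empty.2 hr]⟩
  have h0 : x₀ ∈ Metric.ball x₀ r := Metric.mem_ball_self hr
  have hc : Convex ℝ (Metric.ball x₀ r) := convex_ball x₀ r
  have ho : IsOpen (Metric.ball x₀ r) := Metric.isOpen_ball
  have h1 : ∀ y ∈ Metric.ball x₀ r, fderiv ℝ θ y = fderiv ℝ θ x₀ := fun y hy ↦
    hc.is_const_of_fderivWithin_eq_zero (𝕜 := ℝ)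
      (fun z hz ↦ (((hθ z hz).fderiv_right (m := ∞) (by simp)).differentiableAt
        (by simp)).differentiableWithinAt)
      (fun z hz ↦ by rw [fderivWithin_of_isOpen ho hz, h2 z hz]) hy h0
  set L := fderiv ℝ θ x₀
  have h3 : ∀ y ∈ Metric.ball x₀ r, HasFDerivAt (fun z ↦ θ z - L z) (0 : E →L[ℝ] F) y := by
    intro y hy
    have h := ((hθ y hy).differentiableAt (by simp)).hasFDerivAt.fun_sub
      (L.hasFDerivAt (x := y))
    rwa [h1 y hy, sub_self] at h
  refine ⟨L.toLinearMap.toAffineMap + AffineMap.const ℝ E (θ x₀ - L x₀), fun y hy ↦ ?_⟩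
  have h4 := hc.is_const_of_fderivWithin_eq_zero (𝕜 := ℝ)
    (fun z hz ↦ (h3 z hz).differentiableAt.differentiableWithinAt)
    (fun z hz ↦ by rw [fderivWithin_of_isOpen ho hz, (h3 z hz).fderiv]) hy h0
  simp [← h4]

theorem isAffine_of_hessian_eq_zero [T2Space M] [T2Space M']
    (hD : D.ContMDiffCovariantDerivative ∞) (hflat : IsFlat D)
    (hD' : D'.ContMDiffCovariantDerivative ∞) (hflat' : IsFlat D')
    (hf : ContMDiff (𝓡 n) (𝓡 d) ∞ f)
    (h : ∀ (p : M) (u : TangentSpace (𝓡 n) p), hessian D D' f p u = 0) : IsAffine D D' f := by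
  intro p
  obtain ⟨x, hx, hp⟩ := exists_isAffineChart hD hflat p
  obtain ⟨x', hx', hfp⟩ := exists_isAffineChart hD' hflat' (f p)
  have hV : IsOpen (x.target ∩ x.symm ⁻¹' (f ⁻¹' x'.source)) :=
    x.isOpen_inter_preimage_symm (x'.open_source.preimage hf.continuous)
  obtain ⟨r, hr, hball⟩ := Metric.isOpen_iff.1 hV (x p)
    ⟨x.map_source hp, by simpa [x.left_inv hp] using hfp⟩
  -- The domain of `x` shrinks to the preimage of a ball: the ball gives convexity, and its choice
  -- ensures that `f` maps the new domain into `x'.source`.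
  have hU : IsOpen (x.source ∩ x ⁻¹' Metric.ball (x p) r) :=
    x.isOpen_inter_preimage Metric.isOpen_ball
  obtain ⟨a, ha⟩ := exists_affineMap_eqOn_ball (θ := inCharts f x x') (x₀ := x p) (r := r)
    (fun y hy ↦ contDiffAt_inCharts hf hx.mem_maximalAtlas hx'.mem_maximalAtlas (hball hy).1
      (hball hy).2) (fun y hy ↦ by
        have hy1 := (hball hy).1
        ext1 v
        ext1 u
        have h1 := chartDeriv_hessian hf hx hx' (x.map_target hy1) (hball hy).2
          (coordField x u (x.symm y)) (coordField x v (x.symm y))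
        rw [h, chartDeriv_coordField hx.mem_maximalAtlas (x.map_target hy1),
          chartDeriv_coordField hx.mem_maximalAtlas (x.map_target hy1), x.right_inv hy1] at h1
        rw [← h1]
        simp)
  refine ⟨x.restrOpen _ hU, x', a, hx.restrOpen hU, hx',
    ⟨hp, hp, Metric.mem_ball_self hr⟩, ?_, ?_⟩
  · rintro q ⟨hq, -, hqb⟩
    have := (hball hqb).2
    rwa [mem_preimage, mem_preimage, x.left_inv hq] at this
  · intro y hy
    have hyt : y ∈ x.target := hy.1
    have hq := ((x.restrOpen _ hU).map_target hy).2.2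
    have hq' : x (x.symm y) ∈ Metric.ball (x p) r := hq
    rw [x.right_inv hyt] at hq'
    exact ha y hq'

theorem isHolomorphic_tangentMap_iff_isAffine [T2Space M] [T2Space M']
    (hD : D.ContMDiffCovariantDerivative ∞) (hflat : IsFlat D)
    (hD' : D'.ContMDiffCovariantDerivative ∞) (hflat' : IsFlat D')
    (hf : ContMDiff (𝓡 n) (𝓡 d) ∞ f) :
    IsHolomorphic (𝓡 n).tangent (𝓡 d).tangent (complexStructure D) (complexStructure D')
        (tangentMap (𝓡 n) (𝓡 d) f) ↔ IsAffine D D' f :=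
  (isHolomorphic_tangentMap_iff_hessian hf).trans
    ⟨isAffine_of_hessian_eq_zero hD hflat hD' hflat' hf, hessian_eq_zero_of_isAffine hf⟩

theorem IsAffine.splitEquiv_mfderiv_tangentMap (h : IsAffine D D' f)
    (hf : ContMDiff (𝓡 n) (𝓡 d) ∞ f) (u : TangentBundle (𝓡 n) M)
    (A : TangentSpace (𝓡 n).tangent u) :
    splitEquiv D' (tangentMap (𝓡 n) (𝓡 d) f u)
        (mfderiv (𝓡 n).tangent (𝓡 d).tangent (tangentMap (𝓡 n) (𝓡 d) f) u A)
      = (mfderiv (𝓡 n) (𝓡 d) f u.proj (splitEquiv D u A).1,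
          mfderiv (𝓡 n) (𝓡 d) f u.proj (splitEquiv D u A).2) := by
  rw [DuallyFlat.splitEquiv_mfderiv_tangentMap (D := D) hf, hessian_eq_zero_of_isAffine hf h,
    zero_apply, add_zero]

/-- With zero Hessian, `f_*` acts as `df` on each summand of the splitting. Testing on vectors `(v,
0)` recovers the isometry condition for `f`. -/
theorem IsAffine.isIsometric_tangentMap_iff (h : IsAffine D D' f)
    (hf : ContMDiff (𝓡 n) (𝓡 d) ∞ f) (g : Metric n M) (g' : Metric d M') :
    IsIsometric (𝓡 n).tangent (𝓡 d).tangent (tangentMetric g D) (tangentMetric g' D')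
        (tangentMap (𝓡 n) (𝓡 d) f)
      ↔ IsIsometric (𝓡 n) (𝓡 d) (fun p v w ↦ g.inner p v w) (fun p v w ↦ g'.inner p v w) f := by
  have key : ∀ (u : TangentBundle (𝓡 n) M) (A B : TangentSpace (𝓡 n).tangent u),
      tangentMetric g' D' (tangentMap (𝓡 n) (𝓡 d) f u)
        (mfderiv (𝓡 n).tangent (𝓡 d).tangent (tangentMap (𝓡 n) (𝓡 d) f) u A)
        (mfderiv (𝓡 n).tangent (𝓡 d).tangent (tangentMap (𝓡 n) (𝓡 d) f) u B)
      = g'.inner (f u.proj) (mfderiv (𝓡 n) (𝓡 d) f u.proj (splitEquiv D u A).1)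
          (mfderiv (𝓡 n) (𝓡 d) f u.proj (splitEquiv D u B).1)
        + g'.inner (f u.proj) (mfderiv (𝓡 n) (𝓡 d) f u.proj (splitEquiv D u A).2)
          (mfderiv (𝓡 n) (𝓡 d) f u.proj (splitEquiv D u B).2) := by
    intro u A B
    rw [tangentMetric, h.splitEquiv_mfderiv_tangentMap hf, h.splitEquiv_mfderiv_tangentMap hf]
    rfl
  constructor
  · rintro ⟨-, hT⟩
    refine ⟨hf, fun p v w ↦ ?_⟩
    let U : TangentBundle (𝓡 n) M := ⟨p, 0⟩
    have h1 := hT U ((splitEquiv D U).symm (v, 0)) ((splitEquiv D U).symm (w, 0))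
    rw [key, tangentMetric, LinearEquiv.apply_symm_apply, LinearEquiv.apply_symm_apply] at h1
    simpa using! h1
  · rintro ⟨-, hi⟩
    refine ⟨hf.contMDiff_tangentMap (by simp), fun u A B ↦ ?_⟩
    rw [key, tangentMetric]
    exact congrArg₂ (· + ·) (hi _ _ _) (hi _ _ _)

theorem IsAffine.isSmoothImmersion_tangentMap_iff (h : IsAffine D D' f)
    (hf : ContMDiff (𝓡 n) (𝓡 d) ∞ f) :
    IsSmoothImmersion (𝓡 n).tangent (𝓡 d).tangent (tangentMap (𝓡 n) (𝓡 d) f)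
      ↔ IsSmoothImmersion (𝓡 n) (𝓡 d) f := by
  constructor
  · rintro ⟨-, hT⟩
    refine ⟨hf, fun p v w hvw ↦ ?_⟩
    -- Any vector over `p` would serve, since in the splitting the derivative is `df ⊕ df` whatever
    -- the base vector.
    let U : TangentBundle (𝓡 n) M := ⟨p, 0⟩
    have h1 : (splitEquiv D U).symm (v, 0) = (splitEquiv D U).symm (w, 0) := by
      refine hT U ((splitEquiv D' (tangentMap (𝓡 n) (𝓡 d) f U)).injective ?_)
      rw [h.splitEquiv_mfderiv_tangentMap hf, h.splitEquiv_mfderiv_tangentMap hf,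
        LinearEquiv.apply_symm_apply, LinearEquiv.apply_symm_apply]
      exact Prod.ext hvw rfl
    exact congrArg Prod.fst ((splitEquiv D U).symm.injective h1)
  · rintro ⟨-, hi⟩
    refine ⟨hf.contMDiff_tangentMap (by simp), fun u A B hAB ↦ ?_⟩
    have h1 := congrArg (splitEquiv D' (tangentMap (𝓡 n) (𝓡 d) f u)) hAB
    rw [h.splitEquiv_mfderiv_tangentMap hf, h.splitEquiv_mfderiv_tangentMap hf] at h1
    exact (splitEquiv D u).injective
      (Prod.ext (hi _ (congrArg Prod.fst h1)) (hi _ (congrArg Prod.snd h1)))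

end Main

end DuallyFlat

end

theorem proposition2p19 {n d : ℕ} {M M' : Type*}
    [TopologicalSpace M] [T2Space M] [SecondCountableTopology M] [ConnectedSpace M]
    [ChartedSpace (EuclideanSpace ℝ (Fin n)) M] [IsManifold (𝓡 n) ∞ M]
    [TopologicalSpace M'] [T2Space M'] [SecondCountableTopology M'] [ConnectedSpace M']
    [ChartedSpace (EuclideanSpace ℝ (Fin d)) M'] [IsManifold (𝓡 d) ∞ M']
    (S : DuallyFlat.DuallyFlatStructure n M) (S' : DuallyFlat.DuallyFlatStructure d M')
    (f : M → M') (hf : ContMDiff (𝓡 n) (𝓡 d) ∞ f) :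
    (DuallyFlat.IsHolomorphic (𝓡 n).tangent (𝓡 d).tangent
        (DuallyFlat.complexStructure S.conn) (DuallyFlat.complexStructure S'.conn)
        (tangentMap (𝓡 n) (𝓡 d) f)
      ↔ DuallyFlat.IsAffine S.conn S'.conn f) ∧
    (DuallyFlat.IsAffine S.conn S'.conn f →
      (DuallyFlat.IsIsometric (𝓡 n).tangent (𝓡 d).tangent
          (DuallyFlat.tangentMetric S.metric S.conn) (DuallyFlat.tangentMetric S'.metric S'.conn)
          (tangentMap (𝓡 n) (𝓡 d) f)
        ↔ DuallyFlat.IsIsometric (𝓡 n) (𝓡 d)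
          (fun p v w ↦ S.metric.inner p v w) (fun p v w ↦ S'.metric.inner p v w) f)) ∧
    (DuallyFlat.IsKahlerImmersion (𝓡 n).tangent (𝓡 d).tangent
        (DuallyFlat.tangentMetric S.metric S.conn) (DuallyFlat.complexStructure S.conn)
        (DuallyFlat.tangentMetric S'.metric S'.conn) (DuallyFlat.complexStructure S'.conn)
        (tangentMap (𝓡 n) (𝓡 d) f)
      ↔ DuallyFlat.IsIsometric (𝓡 n) (𝓡 d)
            (fun p v w ↦ S.metric.inner p v w) (fun p v w ↦ S'.metric.inner p v w) f
          ∧ DuallyFlat.IsAffine S.conn S'.conn f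
          ∧ DuallyFlat.IsSmoothImmersion (𝓡 n) (𝓡 d) f) := by
  have hhol := DuallyFlat.isHolomorphic_tangentMap_iff_isAffine S.smooth_conn S.flat_conn
    S'.smooth_conn S'.flat_conn hf
  refine ⟨hhol, fun h ↦ h.isIsometric_tangentMap_iff hf S.metric S'.metric, ?_, ?_⟩
  -- Holomorphy is used first: the other two equivalences are available only once `f` is affine.
  · rintro ⟨h1, h2, h3⟩
    have h := hhol.1 h2
    exact ⟨(h.isIsometric_tangentMap_iff hf S.metric S'.metric).1 h3, h,
      (h.isSmoothImmersion_tangentMap_iff hf).1 h1⟩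
  · rintro ⟨h3, h, h1⟩
    exact ⟨(h.isSmoothImmersion_tangentMap_iff hf).2 h1, hhol.2 h,
      (h.isIsometric_tangentMap_iff hf S.metric S'.metric).2 h3⟩
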